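/- A \emph{graph class} is a nonempty collection $\mathcal{P}$ of finite simple graphs closed under isomorphism; it is \emph{hereditary} if $G\in\mathcal{P}$ implies $G[U]\in\mathcal{P}$ for every nonempty $U\subseteq V(G)$. For a graph $G$, a \emph{maximal $\mathcal{P}$ set} of $G$ is a set $U\subseteq V(G)$ such that $G[U]\in\mathcal{P}$ and $G[W]\notin\mathcal{P}$ for every $W$ with $U\subsetneq W\subseteq V(G)$. The \emph{maximal induced $\mathcal{P}$ subgraphs problem} asks, given a finite graph $G$ (by its adjacency matrix), to output all maximal $\mathcal{P}$ sets of $G$ (by their characteristic vectors), each exactly once. Let $n=|V(G)|$ and let $N$ be the number of maximal $\mathcal{P}$ sets of $G$. The problem is solvable - in \emph{polynomial total time} if there are an algorithm (a deterministic multi-stack Turing machine that outputs the solutions one after another) solving it and a polynomial $p$ such that on every input $G$ the algorithm outputs all solutions and halts within $p(n,N)$ steps; - in \emph{incremental polynomial time} if there are such an algorithm solving it and a polynomial $p$ such that on every input $G$ and for every $1\le s\le N$ the $s$-th solution is output within the first $p(n,s)$ steps, and the algorithm halts within $p(n,N)$ steps. **Theorem.** For every hereditary graph class $\mathcal{P}$,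 the maximal induced $\mathcal{P}$ subgraphs problem is solvable in polynomial total time if and only if it is solvable in incremental polynomial time. -/

import Mathlib

/-! ### Graph classes and maximal `P` sets -/

/-- A graph class: a nonempty collection of finite simple graphs, closed under isomorphism. -/
structure GraphClass where
  /-- membership of a finite graph in the class -/
  Mem : ∀ {V : Type} [Finite V], SimpleGraph V → Prop
  iso_closed : ∀ {V W : Type} [Finite V] [Finite W] (G : SimpleGraph V) (H : SimpleGraph W),
    Nonempty (G ≃g H) → Mem G → Mem H
  nonempty : ∃ (V : Type) (_ : Finite V) (G : SimpleGraph V), Mem G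

namespace GraphClass

/-- A graph class is hereditary if it is closed under taking induced subgraphs
(on nonempty sets of vertices). -/
def Hereditary (P : GraphClass) : Prop :=
  ∀ {V : Type} [Finite V] (G : SimpleGraph V) (U : Set V), U.Nonempty → P.Mem G →
    P.Mem (G.induce U)

/-- `U` is a `P` set of `G` if the subgraph of `G` induced by `U` belongs to the class `P`. -/
def IsSetOf (P : GraphClass) {V : Type} [Finite V] (G : SimpleGraph V) (U : Set V) : Prop :=
  P.Mem (G.induce U)

/-- `U` is a maximal `P` set of `G`: it is a `P` set and no proper superset of it is one. -/
def IsMaximalSetOf (P : GraphClass) {V : Type} [Finite V] (G : SimpleGraph V) (U : Set V) : Prop :=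
  P.IsSetOf G U ∧ ∀ W : Set V, U ⊂ W → ¬ P.IsSetOf G W

/-- The number `N` of solutions, i.e. of maximal `P` sets of `G`. -/
noncomputable def numSolutions (P : GraphClass) {V : Type} [Finite V] (G : SimpleGraph V) : ℕ :=
  {U : Set V | P.IsMaximalSetOf G U}.ncard

end GraphClass

/-! ### Encodings of inputs and outputs -/

open Classical in
/-- The input word of a graph on the vertex set `Fin n`: the rows of its adjacency matrix in order,
every row being followed by the separator `none`. -/
noncomputable def graphCode {n : ℕ} (G : SimpleGraph (Fin n)) : List (Option Bool) :=
  (List.finRange n).flatMap fun i =>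
    (List.finRange n).map (fun j => some (decide (G.Adj i j))) ++ [none]

open Classical in
/-- The output word of a set of vertices: its characteristic vector, of length `n`. -/
noncomputable def vertexSetCode {n : ℕ} (U : Set (Fin n)) : List Bool :=
  (List.finRange n).map fun i => decide (i ∈ U)

/-! ### Enumeration algorithms -/

/-- An enumeration machine: a deterministic multi-stack Turing machine that reads its input word
(over the alphabet `Option Bool`) from its input stack. Some of its control labels are marked as
output labels. Whenever the control is at such a label, the machine outputs one word over `Bool`,
namely the word that its output stack then holds, read from the top of the stack. -/
structure EnumMachine extends Turing.FinTM2 where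
  /-- all stack alphabets are finite -/
  finite_alphabet : ∀ k, Finite (Γ k)
  /-- the alphabet of the input stack -/
  inputAlphabet : Γ k₀ ≃ Option Bool
  /-- the alphabet of the output stack -/
  outputAlphabet : Γ k₁ ≃ Bool
  /-- the marked output labels -/
  emit : Λ → Bool

namespace EnumMachine

/-- The configuration of `M` on the input word `w` after `t` steps
(`none` if `M` has halted in fewer than `t` steps). -/
def cfgAt (M : EnumMachine) (w : List (Option Bool)) : ℕ → Option M.toFinTM2.Cfg
  | 0 => some (Turing.initList M.toFinTM2 (w.map M.inputAlphabet.symm))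
  | t + 1 => (M.cfgAt w t).bind M.toFinTM2.step

/-- The word that a configuration outputs, if its label is an output label. -/
def emitted (M : EnumMachine) (c : M.toFinTM2.Cfg) : Option (List Bool) :=
  match Turing.TM2.Cfg.l c with
  | none => none
  | some l => if M.emit l then some ((Turing.TM2.Cfg.stk c M.k₁).map M.outputAlphabet) else none

/-- The list of all words that `M` outputs on the input word `w` within its first `t` steps,
in the order of their output. -/
def outputs (M : EnumMachine) (w : List (Option Bool)) (t : ℕ) : List (List Bool) :=
  (List.range (t + 1)).filterMap fun u => (M.cfgAt w u).bind M.emitted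

/-- `M` halts on the input word `w` within `t` steps. -/
def HaltsWithin (M : EnumMachine) (w : List (Option Bool)) (t : ℕ) : Prop :=
  ∃ u ≤ t, ∃ c, M.cfgAt w u = some c ∧ Turing.TM2.Cfg.l c = none

/-- On the input graph `G`, the machine `M` halts within `t` steps, having output every
maximal `P` set of `G` exactly once, and nothing else. -/
def EnumeratesWithin (M : EnumMachine) (P : GraphClass) {n : ℕ} (G : SimpleGraph (Fin n))
    (t : ℕ) : Prop :=
  M.HaltsWithin (graphCode G) t ∧ (M.outputs (graphCode G) t).Nodup ∧
    ∀ x, x ∈ M.outputs (graphCode G) t ↔ ∃ U, P.IsMaximalSetOf G U ∧ vertexSetCode U = x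

end EnumMachine

/-! ### Solvability -/

namespace GraphClass

/-- The maximal induced `P` subgraphs problem is solvable in polynomial total time: some machine
enumerates the maximal `P` sets of every graph and halts within a number of steps bounded by a
polynomial in the number `n` of vertices and the number `N` of solutions. -/
def SolvableInPolynomialTotalTime (P : GraphClass) : Prop :=
  ∃ (M : EnumMachine) (p : MvPolynomial (Fin 2) ℕ), ∀ (n : ℕ) (G : SimpleGraph (Fin n)),
    M.EnumeratesWithin P G (MvPolynomial.eval ![n, P.numSolutions G] p)

/-- The maximal induced `P` subgraphs problem is solvable in incremental polynomial time: some
machine enumerates the maximal `P` sets of every graph in such a way that, for `1 ≤ s ≤ N`, the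
`s`-th solution is output within a number of steps bounded by a polynomial in `n` and `s`; after
the `N`-th solution the machine halts, within the bound for `s = N`. -/
def SolvableInIncrementalPolynomialTime (P : GraphClass) : Prop :=
  ∃ (M : EnumMachine) (p : MvPolynomial (Fin 2) ℕ), ∀ (n : ℕ) (G : SimpleGraph (Fin n)),
    (∀ s, 1 ≤ s → s ≤ P.numSolutions G →
      s ≤ (M.outputs (graphCode G) (MvPolynomial.eval ![n, s] p)).length) ∧
    M.EnumeratesWithin P G (MvPolynomial.eval ![n, P.numSolutions G] p)

end GraphClass

open Turing Function

/-! Incremental polynomial time contains a polynomial total time bound by definition, so the content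
is the other direction. Let `M` enumerate within `p(n, N)` steps. A graph in the class has exactly
one solution, its whole vertex set. Hence any budget of at least `p(m, 1)` for all `m ≤ n` decides
whether `G[S]` is in the class: run `M` on `G[S]` within the budget and see whether it outputs the
all-ones vector. By heredity this test extends every `P` set greedily to a maximal one
(`isMaximalSetOf_extend`).

The new machine works in stages with budgets `T`, `T + 1`, .... A stage runs `M` on `G`; if `M`
halts, the solutions it outputs are all of them. Otherwise the vertices are tried once each:
starting from `K = V(G)`, a vertex is deleted from `K` exactly when `M` does not halt on the smaller
graph within the budget. Every set output during any of these runs is extended to a maximal `P` set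
of `G` and reported if it is new. At the end `M` still exceeds the budget on `G[K]`, while for each
`v` in `K` every `P` set inside `K \ {v}` lies in a reported solution (`ex_stage`).

Since `M` halts in time on graphs of the class, `G[K]` is not in it. So each maximal `P` set `U` of
`G[K]` misses a vertex of `K`, is contained in a reported `Z`, and equals `Z ∩ K` by maximality.
Hence `G[K]` has at most as many solutions as have been reported (`numSolutions_sub_le`). If at most
`s` were reported, `M` would halt on `G[K]` within `p(n, s)` steps. Thus after `p(n, s) + 1` stages
either everything is known or more than `s` solutions have been output (`incremental_spec`); with `s
= N` only the first is possible.

The rest realizes this procedure as a stack machine. A small structured language is compiled to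
`TM2` code, with running time at most `cost B p` when all loops have length at most `B`
(`steps_of_exec`); for a fixed program this is polynomial in `B`. The algorithm is written in the
language, and polynomial bounds for its stacks give a polynomial `B`. -/

namespace StackProg

/-! ### Structured programs over stacks -/

section

variable {K : Type} {Γ : K → Type} {σ : Type}

/-- Structured programs over a family of stacks. `pop k b` pops a symbol from `k` and continues with
`b` applied to it, `forEach k b` runs `b c` for every symbol `c` that stack `k` holds on entry. -/
inductive Prog {K : Type} (Γ : K → Type) (σ : Type) : Type
  | push (k : K) (f : σ → Γ k) : Prog Γ σ
  | load (f : σ → σ) : Prog Γ σ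
  | emit : Prog Γ σ
  | seq (p q : Prog Γ σ) : Prog Γ σ
  | ite (c : σ → Bool) (p q : Prog Γ σ) : Prog Γ σ
  | pop (k : K) (b : Option (Γ k) → Prog Γ σ) : Prog Γ σ
  | forEach (k : K) (b : Γ k → Prog Γ σ) : Prog Γ σ

/-- The state of a program: control variables, stacks, and the words emitted so far. -/
@[ext] structure State {K : Type} (Γ : K → Type) (σ : Type) where
  var : σ
  stk : ∀ k, List (Γ k)
  out : List (List Bool)

/-- Running through a list, with one transition of `R` per element. -/
def Loop {α S : Type} (R : α → S → S → Prop) : List α → S → S → Prop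
  | [], s, s' => s' = s
  | c :: l, s, s' => ∃ s₁, R c s s₁ ∧ Loop R l s₁ s'

/-- `Exec rd B p s s'`: the program `p` leads from `s` to `s'`, and all its loops have length at
most `B`. The word emitted by `emit` is computed by `rd`. -/
def Exec [DecidableEq K] (rd : (∀ k, List (Γ k)) → List Bool) (B : ℕ) :
    Prog Γ σ → State Γ σ → State Γ σ → Prop
  | .push k f => fun s s' => s' = { s with stk := update s.stk k (f s.var :: s.stk k) }
  | .load f => fun s s' => s' = { s with var := f s.var }
  | .emit => fun s s' => s' = { s with out := s.out ++ [rd s.stk] }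
  | .seq p q => fun s s' => ∃ s₁, Exec rd B p s s₁ ∧ Exec rd B q s₁ s'
  | .ite c p q => fun s s' => (c s.var = true ∧ Exec rd B p s s') ∨
      (c s.var = false ∧ Exec rd B q s s')
  | .pop k b => fun s s' =>
      Exec rd B (b (s.stk k).head?) { s with stk := update s.stk k (s.stk k).tail } s'
  | .forEach k b => fun s s' => (s.stk k).length ≤ B ∧
      Loop (fun c => Exec rd B (b c)) (s.stk k) s s'

/-- A bound for the number of machine steps when all loops have length at most `B`. -/
def cost [∀ k, Fintype (Γ k)] (B : ℕ) : Prog Γ σ → ℕ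
  | .push _ _ => 1
  | .load _ => 1
  | .emit => 1
  | .seq p q => cost B p + cost B q
  | .ite _ p q => 1 + (cost B p + cost B q)
  | .pop _ b => 1 + ∑ o, cost B (b o)
  -- One step for the marker, `B + 1` to unload the stack, `2 * B + 1` to reload and copy it, `B +
  -- 1` to fetch the symbols, plus the bodies. Summing over all symbols bounds whichever branch is
  -- taken.
  | .forEach _ b => 4 * B + 4 + B * ∑ c, cost B (b c)

/-! ### Compilation -/

/-- Control labels of a compiled program. -/
@[reducible] def Lab : Prog Γ σ → Type
  | .push _ _ => Unit
  | .load _ => Unit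
  | .emit => Unit
  | .seq p q => Lab p ⊕ Lab q
  | .ite _ p q => Option (Lab p ⊕ Lab q)
  | .pop k b => Option (Σ o : Option (Γ k), Lab (b o))
  | .forEach k b => Fin 4 ⊕ Γ k ⊕ Σ c : Γ k, Lab (b c)

/-- The first label of a compiled program. -/
def entry : ∀ p : Prog Γ σ, Lab p
  | .push _ _ => ()
  | .load _ => ()
  | .emit => ()
  | .seq p _ => .inl (entry p)
  | .ite _ _ _ => none
  | .pop _ _ => none
  | .forEach _ _ => .inl 0

/-- The output labels of a compiled program. -/
def isEmit : ∀ p : Prog Γ σ, Lab p → Bool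
  | .push _ _, _ => false
  | .load _, _ => false
  | .emit, _ => true
  | .seq p _, .inl a => isEmit p a
  | .seq _ q, .inr a => isEmit q a
  | .ite _ _ _, none => false
  | .ite _ p _, some (.inl a) => isEmit p a
  | .ite _ _ q, some (.inr a) => isEmit q a
  | .pop _ _, none => false
  | .pop _ b, some ⟨o, a⟩ => isEmit (b o) a
  | .forEach _ _, .inl _ => false
  | .forEach _ _, .inr (.inl _) => false
  | .forEach _ b, .inr (.inr ⟨c, a⟩) => isEmit (b c) a

theorem finite_lab [∀ k, Finite (Γ k)] : ∀ p : Prog Γ σ, Finite (Lab p)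
  | .push _ _ => inferInstanceAs (Finite Unit)
  | .load _ => inferInstanceAs (Finite Unit)
  | .emit => inferInstanceAs (Finite Unit)
  | .seq p q =>
    have := finite_lab p
    have := finite_lab q
    inferInstanceAs (Finite (Lab p ⊕ Lab q))
  | .ite _ p q =>
    have := finite_lab p
    have := finite_lab q
    inferInstanceAs (Finite (Option (Lab p ⊕ Lab q)))
  | .pop k b =>
    have := fun o => finite_lab (b o)
    inferInstanceAs (Finite (Option (Σ o : Option (Γ k), Lab (b o))))
  | .forEach k b =>
    have := fun o => finite_lab (b o)
    inferInstanceAs (Finite (Fin 4 ⊕ Γ k ⊕ Σ c : Γ k, Lab (b c)))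

/-- A register holding at most one stack symbol. -/
abbrev Reg {K : Type} (Γ : K → Type) : Type := Option (Σ k, Γ k)

/-- The stack alphabets of a compiled program: two auxiliary stacks are added. -/
@[reducible] def Alph {K : Type} (Γ : K → Type) : K ⊕ Bool → Type
  | .inl k => Γ k
  | .inr _ => Option (Reg Γ)

/-- The stacks of a compiled program. -/
def hiddenStk (S : ∀ k, List (Γ k)) (t h : List (Option (Reg Γ))) : ∀ k, List (Alph Γ k)
  | .inl k => S k
  | .inr false => t
  | .inr true => h

section

variable [DecidableEq K]

theorem update_hiddenStk_inl (S : ∀ k, List (Γ k)) (t h : List (Option (Reg Γ))) (k : K)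
    (x : List (Γ k)) :
    update (hiddenStk S t h) (Sum.inl k) x = hiddenStk (update S k x) t h := by
  funext j
  rcases j with j | (_ | _)
  · by_cases hj : j = k
    · subst hj; simp [hiddenStk]
    · rw [update_of_ne (by simpa using hj)]; simp [hiddenStk, update_of_ne hj]
  · simp [hiddenStk]
  · simp [hiddenStk]

theorem update_hiddenStk_tmp (S : ∀ k, List (Γ k)) (t h x : List (Option (Reg Γ))) :
    update (hiddenStk S t h) (Sum.inr false) x = hiddenStk S x h := by
  funext j
  rcases j with j | (_ | _) <;> simp [hiddenStk]

theorem update_hiddenStk_hid (S : ∀ k, List (Γ k)) (t h x : List (Option (Reg Γ))) :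
    update (hiddenStk S t h) (Sum.inr true) x = hiddenStk S t x := by
  funext j
  rcases j with j | (_ | _) <;> simp [hiddenStk]

/-- The content of a register as a symbol of stack `k`. -/
def Reg.get (k : K) : Reg Γ → Option (Γ k)
  | none => none
  | some ⟨k', c⟩ => if h : k' = k then some (h ▸ c) else none

@[simp] theorem Reg.get_none (k : K) : Reg.get k (none : Reg Γ) = none := rfl

@[simp] theorem Reg.get_some (k : K) (c : Γ k) : Reg.get k (some ⟨k, c⟩ : Reg Γ) = some c := by
  simp [Reg.get]

/-- The code of a program whose labels are embedded by `e` and which continues at `nx`. -/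
def code {Λ : Type} : ∀ p : Prog Γ σ, (Lab p → Λ) → Λ → Lab p →
    TM2.Stmt (Alph Γ) Λ (σ × Reg Γ)
  | .push k f, _, nx, _ => .push (.inl k) (fun v => f v.1) (.goto fun _ => nx)
  | .load f, _, nx, _ => .load (fun v => (f v.1, v.2)) (.goto fun _ => nx)
  | .emit, _, nx, _ => .goto fun _ => nx
  | .seq p q, e, _, .inl a => code p (fun a => e (.inl a)) (e (.inr (entry q))) a
  | .seq _ q, e, nx, .inr a => code q (fun a => e (.inr a)) nx a
  | .ite c p q, e, _, none => .goto fun v =>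
      if c v.1 then e (some (.inl (entry p))) else e (some (.inr (entry q)))
  | .ite _ p _, e, nx, some (.inl a) => code p (fun a => e (some (.inl a))) nx a
  | .ite _ _ q, e, nx, some (.inr a) => code q (fun a => e (some (.inr a))) nx a
  | .pop k _, e, _, none => .pop (.inl k) (fun v o => (v.1, Option.map (Sigma.mk k) o))
      (.goto fun v => e (some ⟨Reg.get k v.2, entry _⟩))
  | .pop _ b, e, nx, some ⟨o, a⟩ => code (b o) (fun a => e (some ⟨o, a⟩)) nx a
  -- The body may change stack `k`, so the loop runs over a copy. Label 0 puts the marker `none` on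
  -- the hidden stack, which lets nested loops share it; label 1 moves `k` to the temporary stack;
  -- label 2 moves it back and also copies it to the hidden stack; label 3 fetches the next copied
  -- symbol. The double `Option.join` turns both the marker and an empty stack into an empty
  -- register.
  | .forEach k _, e, nx, .inl i =>
      match i with
      | 0 => .push (.inr true) (fun _ => (none : Option (Reg Γ))) (.goto fun _ => e (.inl 1))
      | 1 => .pop (.inl k) (fun v o => (v.1, Option.map (Sigma.mk k) o))
          (.branch (fun v => v.2.isSome)
            (.push (.inr false) (fun v => (some v.2 : Option (Reg Γ))) (.goto fun _ => e (.inl 1)))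
            (.goto fun _ => e (.inl 2)))
      | 2 => .pop (.inr false) (fun v o => (v.1, (Option.join (Option.join o) : Reg Γ)))
          (.goto fun v => (Reg.get k v.2).elim (e (.inl 3)) fun c => e (.inr (.inl c)))
      | 3 => .pop (.inr true) (fun v o => (v.1, (Option.join (Option.join o) : Reg Γ)))
          (.goto fun v => (Reg.get k v.2).elim nx fun c => e (.inr (.inr ⟨c, entry _⟩)))
  | .forEach k _, e, _, .inr (.inl c) =>
      .push (.inl k) (fun _ => c) (.push (.inr true) (fun _ => (some (some ⟨k, c⟩) : Option (Reg Γ)))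
        (.goto fun _ => e (.inl 2)))
  | .forEach _ b, e, _, .inr (.inr ⟨c, a⟩) =>
      code (b c) (fun a => e (.inr (.inr ⟨c, a⟩))) (e (.inl 3)) a

end

/-! ### Runs of machines -/

section

variable {J : Type} [DecidableEq J] {Δ : J → Type} {Λ τ : Type}

/-- The word that a configuration emits, as a list of length at most one. -/
def emission (em : Λ → Bool) (rd : (∀ j, List (Δ j)) → List Bool) (c : TM2.Cfg Δ Λ τ) :
    List (List Bool) :=
  match c.l with
  | none => []
  | some l => if em l then [rd c.stk] else []

/-- `Steps m em rd t c o c'`: from `c` the machine reaches `c'` in `t` steps, emitting `o` on the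
way (not counting an emission of `c'` itself). -/
inductive Steps (m : Λ → TM2.Stmt Δ Λ τ) (em : Λ → Bool) (rd : (∀ j, List (Δ j)) → List Bool) :
    ℕ → TM2.Cfg Δ Λ τ → List (List Bool) → TM2.Cfg Δ Λ τ → Prop
  | refl (c) : Steps m em rd 0 c [] c
  | head {t c o c₁ c'} (h : TM2.step m c = some c₁) (h' : Steps m em rd t c₁ o c') :
      Steps m em rd (t + 1) c (emission em rd c ++ o) c'

variable {m : Λ → TM2.Stmt Δ Λ τ} {em : Λ → Bool} {rd : (∀ j, List (Δ j)) → List Bool}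

theorem Steps.trans {t₁ t₂ : ℕ} {c₁ c₂ c₃ : TM2.Cfg Δ Λ τ} {o₁ o₂ : List (List Bool)}
    (h₁ : Steps m em rd t₁ c₁ o₁ c₂) (h₂ : Steps m em rd t₂ c₂ o₂ c₃) :
    Steps m em rd (t₁ + t₂) c₁ (o₁ ++ o₂) c₃ := by
  induction h₁ with
  | refl c => simpa using h₂
  | head h _ ih =>
    rw [List.append_assoc, Nat.add_right_comm]
    exact .head h (ih h₂)

theorem Steps.silent {t : ℕ} {l : Λ} {v : τ} {S : ∀ j, List (Δ j)} {o : List (List Bool)}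
    {c' : TM2.Cfg Δ Λ τ} (he : em l = false)
    (h : Steps m em rd t (TM2.stepAux (m l) v S) o c') :
    Steps m em rd (t + 1) ⟨some l, v, S⟩ o c' := by
  have := Steps.head (em := em) (rd := rd) (c := ⟨some l, v, S⟩) rfl h
  simpa [emission, he] using this

end

/-- Stack readers of a compiled program. -/
def readVisible (rd : (∀ k, List (Γ k)) → List Bool) (S : ∀ k, List (Alph Γ k)) : List Bool :=
  rd fun k => S (.inl k)

@[simp] theorem readVisible_hiddenStk (rd : (∀ k, List (Γ k)) → List Bool) (S : ∀ k, List (Γ k))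
    (t h : List (Option (Reg Γ))) : readVisible rd (hiddenStk S t h) = rd S := rfl

section

variable [DecidableEq K]

variable {Λ : Type} {m : Λ → TM2.Stmt (Alph Γ) Λ (σ × Reg Γ)} {em : Λ → Bool}
  {rd : (∀ k, List (Γ k)) → List Bool}

/-- The unloading phase of `forEach`: it reverses the symbols, and `steps_back` reverses them again,
so that stack `k` is restored and its copy has the same order. -/
theorem steps_fill {k : K} {b : Γ k → Prog Γ σ} {e : Lab (.forEach k b) → Λ} {nx : Λ}
    (hm : ∀ a, m (e a) = code (.forEach k b) e nx a)
    (hem : ∀ a, em (e a) = isEmit (.forEach k b) a) (v : σ) (h : List (Option (Reg Γ))) :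
    ∀ (l : List (Γ k)) (S : ∀ k, List (Γ k)) (r : Reg Γ) (t : List (Option (Reg Γ))),
      S k = l →
      ∃ r', Steps m em (readVisible rd) (l.length + 1)
        ⟨some (e (.inl 1)), (v, r), hiddenStk S t h⟩ []
        ⟨some (e (.inl 2)), (v, r'),
          hiddenStk (update S k []) ((l.map fun c => some (some ⟨k, c⟩)).reverse ++ t) h⟩
  | [], S, r, t, hS => by
    refine ⟨none, Steps.silent (hem _) ?_⟩
    rw [hm]
    simp only [code, TM2.stepAux, update_hiddenStk_inl]
    have : hiddenStk S t h (Sum.inl k) = S k := rfl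
    rw [this, hS]
    exact .refl _
  | c :: l, S, r, t, hS => by
    obtain ⟨r', h'⟩ := steps_fill hm hem v h l (update S k l) (some ⟨k, c⟩)
      (some (some ⟨k, c⟩) :: t) (by simp)
    refine ⟨r', Steps.silent (hem _) ?_⟩
    rw [hm]
    simp only [code, TM2.stepAux, update_hiddenStk_inl]
    have : hiddenStk S t h (Sum.inl k) = S k := rfl
    rw [this, hS]
    simp only [List.head?_cons, Option.map_some, Option.isSome_some, cond_true,
      update_hiddenStk_tmp, List.tail_cons]
    simpa [hiddenStk] using h'

/-- Each symbol costs two steps, since it is first read into the register and then pushed at a label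
that carries it. -/
theorem steps_back {k : K} {b : Γ k → Prog Γ σ} {e : Lab (.forEach k b) → Λ} {nx : Λ}
    (hm : ∀ a, m (e a) = code (.forEach k b) e nx a)
    (hem : ∀ a, em (e a) = isEmit (.forEach k b) a) (v : σ) :
    ∀ (l : List (Γ k)) (S : ∀ k, List (Γ k)) (r : Reg Γ) (h : List (Option (Reg Γ))),
      ∃ r', Steps m em (readVisible rd) (2 * l.length + 1)
        ⟨some (e (.inl 2)), (v, r), hiddenStk S (l.map fun c => some (some ⟨k, c⟩)) h⟩ []
        ⟨some (e (.inl 3)), (v, r'),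
          hiddenStk (update S k (l.reverse ++ S k)) []
            ((l.map fun c => some (some ⟨k, c⟩)).reverse ++ h)⟩
  | [], S, r, h => by
    refine ⟨none, Steps.silent (hem _) ?_⟩
    rw [hm]
    simp only [code, TM2.stepAux, update_hiddenStk_tmp]
    simpa [hiddenStk] using Steps.refl _
  | c :: l, S, r, h => by
    obtain ⟨r', h'⟩ := steps_back hm hem v l (update S k (c :: S k)) (some ⟨k, c⟩)
      (some (some ⟨k, c⟩) :: h)
    refine ⟨r', Steps.silent (t := 2 * l.length + 1 + 1) (hem _) ?_⟩
    rw [hm]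
    simp only [code, TM2.stepAux, update_hiddenStk_tmp]
    have : hiddenStk S (List.map (fun c => some (some ⟨k, c⟩)) (c :: l)) h (Sum.inr false) =
      some (some ⟨k, c⟩) :: List.map (fun c => some (some ⟨k, c⟩)) l := rfl
    rw [this]
    simp only [List.head?_cons, List.tail_cons, Option.join_some, Reg.get_some, Option.elim_some]
    refine Steps.silent (hem _) ?_
    rw [hm]
    simp only [code, TM2.stepAux, update_hiddenStk_inl, update_hiddenStk_hid]
    simpa [hiddenStk] using h'

/-- A compiled program does what the program does, within the time bound `cost`. -/
theorem steps_of_exec [∀ k, Fintype (Γ k)] {B : ℕ} : ∀ (p : Prog Γ σ) {e : Lab p → Λ} {nx : Λ},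
    (∀ a, m (e a) = code p e nx a) → (∀ a, em (e a) = isEmit p a) →
    ∀ {s s' : State Γ σ}, Exec rd B p s s' → ∀ (r : Reg Γ) (h : List (Option (Reg Γ))),
    ∃ r' t o, t ≤ cost B p ∧ s'.out = s.out ++ o ∧ Steps m em (readVisible rd) t
      ⟨some (e (entry p)), (s.var, r), hiddenStk s.stk [] h⟩ o
      ⟨some nx, (s'.var, r'), hiddenStk s'.stk [] h⟩
  | .push k f, e, nx, hm, hem, s, s', hs, r, h => by
    obtain rfl := hs
    refine ⟨r, 1, [], le_rfl, by simp, Steps.silent (hem _) ?_⟩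
    rw [hm]
    simp only [code, TM2.stepAux, update_hiddenStk_inl]
    exact .refl _
  | .load f, e, nx, hm, hem, s, s', hs, r, h => by
    obtain rfl := hs
    refine ⟨r, 1, [], le_rfl, by simp, Steps.silent (hem _) ?_⟩
    rw [hm]
    exact .refl _
  | .emit, e, nx, hm, hem, s, s', hs, r, h => by
    obtain rfl := hs
    refine ⟨r, 1, [rd s.stk], le_rfl, rfl, ?_⟩
    have := Steps.head (m := m) (em := em) (rd := readVisible rd)
      (c := ⟨some (e ()), (s.var, r), hiddenStk s.stk [] h⟩) rfl (.refl _)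
    rw [hm] at this
    simpa [emission, hem, isEmit, code, entry] using this
  | .seq p q, e, nx, hm, hem, s, s', ⟨s₁, h₁, h₂⟩, r, h => by
    obtain ⟨r₁, t₁, o₁, ht₁, ho₁, hs₁⟩ := steps_of_exec p (e := fun a => e (.inl a))
      (nx := e (.inr (entry q))) (fun a => hm _) (fun a => hem _) h₁ r h
    obtain ⟨r₂, t₂, o₂, ht₂, ho₂, hs₂⟩ := steps_of_exec q (e := fun a => e (.inr a))
      (nx := nx) (fun a => hm _) (fun a => hem _) h₂ r₁ h
    exact ⟨r₂, t₁ + t₂, o₁ ++ o₂, Nat.add_le_add ht₁ ht₂, by rw [ho₂, ho₁, List.append_assoc],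
      hs₁.trans hs₂⟩
  | .ite c p q, e, nx, hm, hem, s, s', hs, r, h => by
    rcases hs with ⟨hc, hs⟩ | ⟨hc, hs⟩
    · obtain ⟨r₁, t₁, o₁, ht₁, ho₁, hs₁⟩ := steps_of_exec p (e := fun a => e (some (.inl a)))
        (nx := nx) (fun a => hm _) (fun a => hem _) hs r h
      refine ⟨r₁, t₁ + 1, o₁, by simp only [cost]; omega, ho₁, Steps.silent (hem _) ?_⟩
      rw [hm]
      simpa [code, hc, entry] using hs₁
    · obtain ⟨r₁, t₁, o₁, ht₁, ho₁, hs₁⟩ := steps_of_exec q (e := fun a => e (some (.inr a)))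
        (nx := nx) (fun a => hm _) (fun a => hem _) hs r h
      refine ⟨r₁, t₁ + 1, o₁, by simp only [cost]; omega, ho₁, Steps.silent (hem _) ?_⟩
      rw [hm]
      simpa [code, hc, entry] using hs₁
  | .pop k b, e, nx, hm, hem, s, s', hs, r, h => by
    obtain ⟨r₁, t₁, o₁, ht₁, ho₁, hs₁⟩ := steps_of_exec (b (s.stk k).head?)
      (e := fun a => e (some ⟨_, a⟩)) (nx := nx) (fun a => hm _) (fun a => hem _) hs
      (Option.map (Sigma.mk k) (s.stk k).head?) h
    refine ⟨r₁, t₁ + 1, o₁, ?_, ho₁, Steps.silent (hem _) ?_⟩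
    · have := Finset.single_le_sum (f := fun o => cost B (b o)) (fun _ _ => Nat.zero_le _)
        (Finset.mem_univ (s.stk k).head?)
      simp only [cost]
      omega
    · rw [hm]
      simp only [entry, code, TM2.stepAux, update_hiddenStk_inl]
      have : hiddenStk s.stk [] h (Sum.inl k) = s.stk k := rfl
      rw [this]
      have hg : Reg.get k (Option.map (Sigma.mk k) (s.stk k).head? : Reg Γ) = (s.stk k).head? := by
        cases (s.stk k).head? <;> simp
      have he : e (some ⟨Reg.get k (Option.map (Sigma.mk k) (s.stk k).head? : Reg Γ), entry (b _)⟩) =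
          e (some ⟨(s.stk k).head?, entry (b _)⟩) := by rw [hg]
      rw [← he] at hs₁
      exact hs₁
  | .forEach k b, e, nx, hm, hem, s, s', ⟨hB, hs⟩, r, h => by
    -- The fetching phase, with the remaining symbols `l` above the marker. The body leaves the
    -- hidden stack as it found it, so induction on `l` applies.
    have loop : ∀ (l : List (Γ k)) (s : State Γ σ) (r : Reg Γ),
        Loop (fun c => Exec rd B (b c)) l s s' → ∃ r' t o,
        t ≤ 1 + l.length + l.length * ∑ c, cost B (b c) ∧ s'.out = s.out ++ o ∧
        Steps m em (readVisible rd) t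
        ⟨some (e (.inl 3)), (s.var, r),
          hiddenStk s.stk [] ((l.map fun c => some (some ⟨k, c⟩)) ++ none :: h)⟩ o
        ⟨some nx, (s'.var, r'), hiddenStk s'.stk [] h⟩ := by
      intro l
      induction l with
      | nil =>
        rintro s r rfl
        refine ⟨none, 1, [], by simp, by simp, Steps.silent (hem _) ?_⟩
        rw [hm]
        simp only [code, TM2.stepAux, update_hiddenStk_hid]
        simpa [hiddenStk] using Steps.refl _
      | cons c l ih =>
        rintro s r ⟨s₁, h₁, h₂⟩
        obtain ⟨r₁, t₁, o₁, ht₁, ho₁, hs₁⟩ := steps_of_exec (b c)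
          (e := fun a => e (.inr (.inr ⟨c, a⟩))) (nx := e (.inl 3)) (fun a => hm _) (fun a => hem _)
          h₁ (some ⟨k, c⟩) ((l.map fun c => some (some ⟨k, c⟩)) ++ none :: h)
        obtain ⟨r₂, t₂, o₂, ht₂, ho₂, hs₂⟩ := ih s₁ r₁ h₂
        refine ⟨r₂, t₁ + t₂ + 1, o₁ ++ o₂, ?_, by rw [ho₂, ho₁, List.append_assoc],
          Steps.silent (hem _) ?_⟩
        · have := Finset.single_le_sum (f := fun o => cost B (b o)) (fun _ _ => Nat.zero_le _)
            (Finset.mem_univ c)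
          simp only [List.length_cons, Nat.add_mul, one_mul] at this ⊢
          omega
        · rw [hm]
          simp only [code, TM2.stepAux, update_hiddenStk_hid]
          simpa [hiddenStk] using hs₁.trans hs₂
    obtain ⟨r₁, h₁⟩ := steps_fill (rd := rd) hm hem s.var (none :: h) (s.stk k) s.stk r [] rfl
    obtain ⟨r₂, h₂⟩ := steps_back (rd := rd) hm hem s.var (s.stk k).reverse
      (update s.stk k []) r₁ (none :: h)
    obtain ⟨r₃, t₃, o₃, ht₃, ho₃, h₃⟩ := loop (s.stk k) s r₂ hs
    refine ⟨r₃, _, o₃, ?_, ho₃, Steps.silent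
      (t := (s.stk k).length + 1 + (2 * (s.stk k).reverse.length + 1) + t₃) (hem _) ?_⟩
    · have := Nat.mul_le_mul_right (∑ c, cost B (b c)) hB
      simp only [cost, List.length_reverse]
      omega
    · rw [hm]
      simp only [entry, code, TM2.stepAux, update_hiddenStk_hid]
      rw [List.append_nil, ← List.map_reverse] at h₁
      simp only [update_self, List.append_nil, List.reverse_reverse, update_idem, update_eq_self,
        List.map_reverse] at h₂
      rw [← List.map_reverse] at h₂
      simpa [hiddenStk] using (h₁.trans h₂).trans h₃

end

end

section

/-! ### The stacks and control variables of the enumeration program -/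

/-- The program's own stacks: the input graph `inp`, the output word `out`, the unary step budget
`budget`, a vector `ones` with an entry per vertex, the vertex set `cur` on which the simulated
machine is run, its adjacency code `word`, the collected words `res`, the list `found` of the
solutions emitted so far, the arguments and zippers of the procedures, and scratch stacks. -/
inductive Var
  | inp | out | budget | ones | cur | word | copy | res | block | arg | left | right | outerLeft
  | outerRight | cmp | tmp | found
  deriving DecidableEq

instance : Fintype Var where
  elems := {.inp, .out, .budget, .ones, .cur, .word, .copy, .res, .block, .arg, .left, .right,
    .outerLeft, .outerRight, .cmp, .tmp, .found}
  complete v := by cases v <;> simp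

/-- The alphabets of the program's own stacks. -/
@[reducible] def Var.alph : Var → Type
  | inp => Option Bool
  | out => Bool
  | budget => Unit
  | ones => Bool
  | cur => Bool
  | word => Option Bool
  | copy => Option Bool
  | res => Option Bool
  | block => Bool
  | arg => Bool
  | left => Bool
  | right => Bool
  | outerLeft => Bool
  | outerRight => Bool
  | cmp => Bool
  | tmp => Bool
  | found => Option Bool

instance (v : Var) : Fintype v.alph := by cases v <;> infer_instance

/-- Control variables: those of the simulated machine, and flags. -/
@[ext] structure Ctl (M : EnumMachine) where
  lab : Option M.Λ
  mv : M.σ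
  good : Bool
  full : Bool
  halted : Bool
  solved : Bool
  dup : Bool
  same : Bool
  finished : Bool

instance (M : EnumMachine) : Finite (Ctl M) := by
  have := M.ΛFin
  have := M.σFin
  refine Finite.of_injective (β := Option M.Λ × M.σ × (Bool × Bool × Bool) × Bool × Bool × Bool × Bool)
    (fun c => (c.lab, c.mv, (c.good, c.full, c.halted), c.solved, c.dup, c.same, c.finished)) ?_
  intro c d h
  simp only [Prod.mk.injEq] at h
  ext <;> simp [h]

/-- The stack alphabets of the program: those of the simulated machine and its own ones. -/
@[reducible] def SimAlph (M : EnumMachine) : M.K ⊕ Var → Type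
  | .inl k => M.Γ k
  | .inr v => v.alph

/-- The state of the program, unbundled. -/
structure St (M : EnumMachine) where
  ctl : Ctl M
  mst : ∀ k, List (M.Γ k)
  inp : List (Option Bool)
  out : List Bool
  budget : List Unit
  ones : List Bool
  cur : List Bool
  word : List (Option Bool)
  copy : List (Option Bool)
  res : List (Option Bool)
  block : List Bool
  arg : List Bool
  left : List Bool
  right : List Bool
  outerLeft : List Bool
  outerRight : List Bool
  cmp : List Bool
  tmp : List Bool
  found : List (Option Bool)
  trace : List (List Bool)

namespace St

variable {M : EnumMachine}

/-- The content of an own stack. -/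
def get (s : St M) : ∀ v : Var, List v.alph
  | .inp => s.inp
  | .out => s.out
  | .budget => s.budget
  | .ones => s.ones
  | .cur => s.cur
  | .word => s.word
  | .copy => s.copy
  | .res => s.res
  | .block => s.block
  | .arg => s.arg
  | .left => s.left
  | .right => s.right
  | .outerLeft => s.outerLeft
  | .outerRight => s.outerRight
  | .cmp => s.cmp
  | .tmp => s.tmp
  | .found => s.found

/-- Replace the content of an own stack. -/
def set (s : St M) : ∀ v : Var, List v.alph → St M
  | .inp, x => { s with inp := x }
  | .out, x => { s with out := x }
  | .budget, x => { s with budget := x }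
  | .ones, x => { s with ones := x }
  | .cur, x => { s with cur := x }
  | .word, x => { s with word := x }
  | .copy, x => { s with copy := x }
  | .res, x => { s with res := x }
  | .block, x => { s with block := x }
  | .arg, x => { s with arg := x }
  | .left, x => { s with left := x }
  | .right, x => { s with right := x }
  | .outerLeft, x => { s with outerLeft := x }
  | .outerRight, x => { s with outerRight := x }
  | .cmp, x => { s with cmp := x }
  | .tmp, x => { s with tmp := x }
  | .found, x => { s with found := x }

/-- The state as a state of the programming language. -/
def toState (s : St M) : State (SimAlph M) (Ctl M) where
  var := s.ctl
  stk
    | .inl k => s.mst k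
    | .inr v => s.get v
  out := s.trace

theorem get_set_self (s : St M) (v : Var) (x : List v.alph) : (s.set v x).get v = x := by
  cases v <;> rfl

theorem get_set_ne (s : St M) {v w : Var} (h : w ≠ v) (x : List v.alph) :
    (s.set v x).get w = s.get w := by
  cases v <;> cases w <;> first | rfl | exact absurd rfl h

theorem set_set (s : St M) (v : Var) (x y : List v.alph) : (s.set v x).set v y = s.set v y := by
  cases v <;> rfl

theorem set_get (s : St M) (v : Var) : s.set v (s.get v) = s := by
  cases v <;> rfl

theorem ctl_set (s : St M) (v : Var) (x : List v.alph) : (s.set v x).ctl = s.ctl := by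
  cases v <;> rfl

theorem mst_set (s : St M) (v : Var) (x : List v.alph) : (s.set v x).mst = s.mst := by
  cases v <;> rfl

theorem trace_set (s : St M) (v : Var) (x : List v.alph) : (s.set v x).trace = s.trace := by
  cases v <;> rfl

/-- Record updates of `St` correspond to function updates of `State`; the correctness proofs can
therefore compute with named fields. -/
theorem toState_set (s : St M) (v : Var) (x : List v.alph) :
    (s.set v x).toState = { s.toState with stk := update s.toState.stk (.inr v) x } := by
  refine State.ext (ctl_set s v x) (funext fun k => ?_) (trace_set s v x)
  rcases k with k | w
  · simp [toState, mst_set]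
  · by_cases h : w = v
    · subst h
      simp [toState, get_set_self]
    · have := update_of_ne (β := fun k => List (SimAlph M k)) (a := Sum.inr w) (a' := Sum.inr v)
        (by simpa using h) x s.toState.stk
      exact (get_set_ne s h x).trans this.symm

theorem toState_setMst (s : St M) (k : M.K) (x : List (M.Γ k)) :
    ({ s with mst := update s.mst k x } : St M).toState =
      { s.toState with stk := update s.toState.stk (.inl k) x } := by
  refine State.ext rfl (funext fun j => ?_) rfl
  rcases j with j | w
  · by_cases h : j = k
    · subst h
      simp [toState]
    · exact (update_of_ne h x s.mst).trans
        (update_of_ne (a := Sum.inl j) (a' := Sum.inl k) (by simpa using h) x s.toState.stk).symm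
  · cases w <;> rfl

end St

variable {M : EnumMachine}

/-- Programs of the enumeration algorithm. -/
abbrev Pr (M : EnumMachine) := Prog (SimAlph M) (Ctl M)

/-- The word on the output stack. -/
def outWord (S : ∀ k, List (SimAlph M k)) : List Bool := S (.inr .out)

/-- Execution of a program, on unbundled states. -/
def Ex (B : ℕ) (p : Pr M) (s s' : St M) : Prop := Exec outWord B p s.toState s'.toState

/-- Execution of a loop, on unbundled states. -/
def ExLoop {α : Type} (B : ℕ) (b : α → Pr M) (l : List α) (s s' : St M) : Prop :=
  Loop (fun c => Exec outWord B (b c)) l s.toState s'.toState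

variable {B : ℕ} {s s₁ s₂ s' : St M}

theorem Ex.of_eq {p : Pr M} (h₁ : Ex B p s s₁) (h₂ : s₁ = s') : Ex B p s s' := h₂ ▸ h₁

theorem Ex.seq {p q : Pr M} (h₁ : Ex B p s s₁) (h₂ : Ex B q s₁ s₂) : Ex B (.seq p q) s s₂ :=
  ⟨_, h₁, h₂⟩

theorem Ex.push {v : Var} {f : Ctl M → v.alph} :
    Ex B (.push (.inr v) f : Pr M) s (s.set v (f s.ctl :: s.get v)) := by
  unfold Ex Exec
  rw [St.toState_set]
  rfl

theorem Ex.pushM {k : M.K} {f : Ctl M → M.Γ k} :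
    Ex B (.push (.inl k) f : Pr M) s { s with mst := update s.mst k (f s.ctl :: s.mst k) } := by
  unfold Ex Exec
  rw [St.toState_setMst]
  rfl

theorem Ex.load {f : Ctl M → Ctl M} :
    Ex B (.load f : Pr M) s { s with ctl := f s.ctl } := rfl

theorem Ex.emit : Ex B (.emit : Pr M) s { s with trace := s.trace ++ [s.out] } := rfl

theorem Ex.ite {c : Ctl M → Bool} {p q : Pr M} (h₁ : c s.ctl = true → Ex B p s s')
    (h₂ : c s.ctl = false → Ex B q s s') : Ex B (.ite c p q) s s' := by
  cases h : c s.ctl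
  · exact .inr ⟨h, h₂ h⟩
  · exact .inl ⟨h, h₁ h⟩

theorem Ex.pop {v : Var} {b : Option v.alph → Pr M}
    (h : Ex B (b (s.get v).head?) (s.set v (s.get v).tail) s') : Ex B (.pop (.inr v) b : Pr M) s s' := by
  unfold Ex at h
  rw [St.toState_set] at h
  exact h

theorem Ex.popM {k : M.K} {b : Option (M.Γ k) → Pr M}
    (h : Ex B (b (s.mst k).head?) { s with mst := update s.mst k (s.mst k).tail } s') :
    Ex B (.pop (.inl k) b : Pr M) s s' := by
  unfold Ex at h
  rw [St.toState_setMst] at h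
  exact h

theorem Ex.forEach {v : Var} {b : v.alph → Pr M} {l : List v.alph} (hl : s.get v = l)
    (hB : l.length ≤ B) (h : ExLoop B b l s s') : Ex B (.forEach (.inr v) b : Pr M) s s' := by
  subst hl
  exact ⟨hB, h⟩

theorem Ex.forEachM {k : M.K} {b : M.Γ k → Pr M} (hB : (s.mst k).length ≤ B)
    (h : ExLoop B b (s.mst k) s s') : Ex B (.forEach (.inl k) b : Pr M) s s' :=
  ⟨hB, h⟩

section

variable {α : Type} {b : α → Pr M}

theorem ExLoop.nil : ExLoop B b [] s s := rfl

theorem ExLoop.of_eq {l : List α} (h₁ : ExLoop B b l s s₁) (h₂ : s₁ = s') : ExLoop B b l s s' :=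
  h₂ ▸ h₁

theorem ExLoop.cons {c : α} {l : List α} (h₁ : Ex B (b c) s s₁) (h₂ : ExLoop B b l s₁ s') :
    ExLoop B b (c :: l) s s' := ⟨_, h₁, h₂⟩

theorem ExLoop.append {l₁ l₂ : List α} (h₁ : ExLoop B b l₁ s s₁) (h₂ : ExLoop B b l₂ s₁ s') :
    ExLoop B b (l₁ ++ l₂) s s' := by
  unfold ExLoop at h₁ h₂ ⊢
  generalize s.toState = x at h₁ ⊢
  induction l₁ generalizing x with
  | nil => obtain rfl := h₁; exact h₂
  | cons c l ih => obtain ⟨y, hy, h₁⟩ := h₁; exact ⟨y, hy, ih _ h₁⟩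

/-- Loop rule for a state that is an explicit function of the iteration number. The variant
`ExLoop.exists_of_index` takes an invariant instead, for loops whose state depends on earlier
choices. -/
theorem ExLoop.of_index {l : List α} {I : ℕ → St M}
    (h : ∀ i (hi : i < l.length), Ex B (b l[i]) (I i) (I (i + 1))) :
    ExLoop B b l (I 0) (I l.length) := by
  induction l generalizing I with
  | nil => exact .nil
  | cons c l ih =>
    refine .cons (h 0 (by simp)) (ih (I := fun i => I (i + 1)) fun i hi => ?_)
    exact h (i + 1) (by simpa using hi)

theorem ExLoop.exists_of_index {l : List α} {I : ℕ → St M → Prop} (h₀ : I 0 s)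
    (h : ∀ i (hi : i < l.length) s, I i s → ∃ s', Ex B (b l[i]) s s' ∧ I (i + 1) s') :
    ∃ s', ExLoop B b l s s' ∧ I l.length s' := by
  induction l generalizing s I with
  | nil => exact ⟨s, .nil, h₀⟩
  | cons c l ih =>
    obtain ⟨s₁, h₁, hI⟩ := h 0 (by simp) s h₀
    obtain ⟨s', h', hI'⟩ := ih (I := fun i => I (i + 1)) hI fun i hi s hs => by
      exact h (i + 1) (by simpa using hi) s hs
    exact ⟨s', .cons h₁ h', hI'⟩

end

/-! ### Basic procedures -/

/-- The program that does nothing. -/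
def skip : Pr M := .load id

theorem Ex.skip : Ex B (skip : Pr M) s s := rfl

/-- Push the content of `a`, in reverse order, on `b`. -/
def pour (a b : Var) (g : a.alph → b.alph) : Pr M :=
  .forEach (.inr a) fun c => .push (.inr b) fun _ => g c

theorem Ex.pour {a b : Var} {g : a.alph → b.alph} (hB : (s.get a).length ≤ B) :
    Ex B (pour a b g) s (s.set b (((s.get a).map g).reverse ++ s.get b)) := by
  refine .forEach rfl hB ?_
  clear hB
  generalize s.get a = l
  induction l generalizing s with
  | nil => simpa [St.set_get] using ExLoop.nil
  | cons c l ih =>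
    refine .cons .push ?_
    have := ih (s := s.set b (g c :: s.get b))
    simpa [St.set_set, St.get_set_self] using this

/-- Empty the stack `a`. -/
def clear (a : Var) : Pr M :=
  .forEach (.inr a) fun _ => .pop (.inr a) fun _ => skip

theorem Ex.clear {a : Var} (hB : (s.get a).length ≤ B) :
    Ex B (clear a) s (s.set a []) := by
  refine .forEach rfl hB ?_
  clear hB
  obtain ⟨l, hl⟩ : ∃ l, s.get a = l := ⟨_, rfl⟩
  rw [hl]
  induction l generalizing s with
  | nil =>
    have : s.set a [] = s := by rw [← hl, St.set_get]
    rw [this]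
    exact .nil
  | cons c l ih =>
    refine .cons (.pop .skip) ?_
    have hg : (s.set a (s.get a).tail).get a = l := by rw [St.get_set_self, hl]; rfl
    have := ih (s := s.set a (s.get a).tail) hg
    rwa [St.set_set] at this

/-- Empty the stack `k` of the simulated machine. -/
def clearM (k : M.K) : Pr M :=
  .forEach (.inl k) fun _ => .pop (.inl k) fun _ => skip

theorem Ex.clearM {k : M.K} (hB : (s.mst k).length ≤ B) :
    Ex B (clearM k) s { s with mst := update s.mst k [] } := by
  refine .forEachM hB ?_
  clear hB
  obtain ⟨l, hl⟩ : ∃ l, s.mst k = l := ⟨_, rfl⟩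
  rw [hl]
  induction l generalizing s with
  | nil =>
    have : update s.mst k [] = s.mst := by rw [← hl, update_eq_self]
    rw [this]
    exact .nil
  | cons c l ih =>
    refine .cons (.popM .skip) ?_
    have hg : update s.mst k (s.mst k).tail k = l := by rw [update_self, hl]; rfl
    have := ih (s := { s with mst := update s.mst k (s.mst k).tail }) hg
    simpa using this

/-- Empty all stacks of the simulated machine. -/
noncomputable def clearAllM : Pr M :=
  M.kFin.elems.toList.foldr (fun k p => .seq (clearM k) p) skip

theorem Ex.clearAllM (hB : ∀ k, (s.mst k).length ≤ B) :
    Ex B clearAllM s { s with mst := fun _ => [] } := by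
  -- Invariant of the fold: stacks that are not in the remaining list are already empty.
  have key : ∀ (l : List M.K) (s : St M), (∀ k, (s.mst k).length ≤ B) → (∀ k ∉ l, s.mst k = []) →
      Ex B (l.foldr (fun k p => .seq (StackProg.clearM k) p) StackProg.skip : Pr M) s
        { s with mst := fun _ => [] } := by
    intro l
    induction l with
    | nil =>
      intro s _ h
      have : s.mst = fun _ => [] := funext fun k => h k (by simp)
      rw [← this]
      exact .skip
    | cons k l ih =>
      intro s hB h
      refine .seq (.clearM (hB k)) ?_
      refine ih { s with mst := update s.mst k [] } (fun j => ?_) fun j hj => ?_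
      · by_cases hjk : j = k
        · subst hjk; simp
        · simpa [update_of_ne hjk] using hB j
      · by_cases hjk : j = k
        · subst hjk; simp
        · simpa [update_of_ne hjk] using h j (by simp [hjk, hj])
  exact key _ s hB fun k hk => absurd (Finset.mem_toList.2 (M.kFin.complete k)) hk

/-! ### Simulation of a machine -/

/-- The configuration of the simulated machine. -/
def St.cfg (s : St M) : TM2.Cfg M.Γ M.Λ M.σ := ⟨s.ctl.lab, s.ctl.mv, s.mst⟩

/-- Replace the configuration of the simulated machine. -/
def St.setCfg (s : St M) (c : TM2.Cfg M.Γ M.Λ M.σ) : St M :=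
  { s with ctl := { s.ctl with lab := c.l, mv := c.var }, mst := c.stk }

/-- The program that executes a statement of the simulated machine. -/
def ofStmt : TM2.Stmt M.Γ M.Λ M.σ → Pr M
  | .push k f q => .seq (.push (.inl k) fun c => f c.mv) (ofStmt q)
  | .peek k f q => .seq (.pop (.inl k) fun o => match o with
      | none => .load fun c => { c with mv := f c.mv none }
      | some a => .seq (.push (.inl k) fun _ => a) (.load fun c => { c with mv := f c.mv (some a) }))
      (ofStmt q)
  | .pop k f q => .seq (.pop (.inl k) fun o => .load fun c => { c with mv := f c.mv o }) (ofStmt q)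
  | .load f q => .seq (.load fun c => { c with mv := f c.mv }) (ofStmt q)
  | .branch f p q => .ite (fun c => f c.mv) (ofStmt p) (ofStmt q)
  | .goto f => .load fun c => { c with lab := some (f c.mv) }
  | .halt => .load fun c => { c with lab := none }

theorem Ex.ofStmt : ∀ (q : TM2.Stmt M.Γ M.Λ M.σ) (s : St M),
    Ex B (ofStmt q) s (s.setCfg (TM2.stepAux q s.ctl.mv s.mst))
  | .push k f q, s => .seq .pushM (Ex.ofStmt q { s with mst := _ })
  | .peek k f q, s => by
    refine .seq (s₁ := { s with ctl := { s.ctl with mv := f s.ctl.mv (s.mst k).head? } })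
      (.popM ?_) (Ex.ofStmt q _)
    cases h : s.mst k with
    | nil =>
      rw [List.tail_nil, ← h, update_eq_self, h]
      exact .load
    | cons a l =>
      refine .seq .pushM ?_
      simp only [update_idem, List.tail_cons, update_self, List.head?_cons]
      rw [← h, update_eq_self]
      exact .load
  | .pop k f q, s => .seq (.popM .load) (Ex.ofStmt q _)
  | .load f q, s => .seq .load (Ex.ofStmt q _)
  | .branch f p q, s => by
    refine .ite (fun h => ?_) fun h => ?_
    · simpa only [TM2.stepAux, h, cond_true] using Ex.ofStmt p s
    · simpa only [TM2.stepAux, h, cond_false] using Ex.ofStmt q s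
  | .goto f, s => .load
  | .halt, s => .load

/-- One step of a machine, where halting configurations are repeated. -/
def simStep (M : EnumMachine) (c : TM2.Cfg M.Γ M.Λ M.σ) : TM2.Cfg M.Γ M.Λ M.σ :=
  (TM2.step M.m c).getD c

open Classical in
/-- The program for one step of the simulated machine. -/
noncomputable def stepM : Pr M :=
  M.ΛFin.elems.toList.foldr
    (fun l p => .ite (fun c => decide (c.lab = some l)) (ofStmt (M.m l)) p) skip

/-- The labels are finitely many and are tested one by one. In a halted configuration no test
succeeds, which agrees with `simStep` repeating it. -/
theorem Ex.stepM : Ex B stepM s (s.setCfg (simStep M s.cfg)) := by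
  classical
  have key : ∀ (ls : List M.Λ), (∀ l, s.ctl.lab = some l → l ∈ ls) →
      Ex B (ls.foldr (fun l p => .ite (fun c => decide (c.lab = some l)) (StackProg.ofStmt (M.m l)) p)
        StackProg.skip : Pr M) s (s.setCfg (simStep M s.cfg)) := by
    intro ls
    induction ls with
    | nil =>
      intro h
      have hl : s.ctl.lab = none := by
        cases hl : s.ctl.lab with
        | none => rfl
        | some l => simpa using h l hl
      have : s.setCfg (simStep M s.cfg) = s := by
        simp only [St.cfg, hl, simStep, TM2.step, Option.getD_none, St.setCfg]
        rw [← hl]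
      rw [this]
      exact .skip
    | cons l ls ih =>
      intro h
      refine .ite (fun hl => ?_) fun hl => ih fun l' hl' => ?_
      · have hl : s.ctl.lab = some l := by simpa using hl
        simp only [St.cfg, hl, simStep, TM2.step, Option.getD_some]
        exact Ex.ofStmt _ _
      · have := h l' hl'
        simp only [List.mem_cons] at this
        rcases this with rfl | h'
        · simp [hl'] at hl
        · exact h'
  refine Eq.mp ?_ (key _ fun l _ => Finset.mem_toList.2 (M.ΛFin.complete l))
  unfold StackProg.stepM
  rfl

end

section

/-! ### Induced subgraphs on initial segments of the natural numbers -/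

section

variable {n : ℕ}

open Classical in
/-- The characteristic function of a set of vertices. -/
noncomputable def ind (S : Set (Fin n)) (i : Fin n) : Bool := decide (i ∈ S)

theorem ind_eq_true {S : Set (Fin n)} {i : Fin n} : ind S i = true ↔ i ∈ S := by simp [ind]

theorem ind_eq_false {S : Set (Fin n)} {i : Fin n} : ind S i = false ↔ i ∉ S := by simp [ind]

theorem vertexSetCode_eq (S : Set (Fin n)) : vertexSetCode S = (List.finRange n).map (ind S) := rfl

@[simp] theorem length_vertexSetCode (S : Set (Fin n)) : (vertexSetCode S).length = n := by
  simp [vertexSetCode_eq]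

/-- The elements of a set of vertices in increasing order. -/
noncomputable def elems (S : Set (Fin n)) : List (Fin n) := (List.finRange n).filter (ind S)

open Classical in
/-- The row of a vertex in the code of a graph, restricted to some columns. -/
noncomputable def rowCode (G : SimpleGraph (Fin n)) (l : List (Fin n)) (i : Fin n) :
    List (Option Bool) :=
  l.map (fun j => some (decide (G.Adj i j))) ++ [none]

theorem graphCode_eq (G : SimpleGraph (Fin n)) :
    graphCode G = (List.finRange n).flatMap (rowCode G (List.finRange n)) := rfl

theorem length_graphCode (G : SimpleGraph (Fin n)) : (graphCode G).length = n * (n + 1) := by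
  simp [graphCode_eq, rowCode, List.length_flatMap]

/-- The subgraph induced by `S`, with the vertices renumbered. -/
noncomputable def sub (G : SimpleGraph (Fin n)) (S : Set (Fin n)) :
    SimpleGraph (Fin (elems S).length) := G.comap (elems S).get

/-- The increasing renumbering makes the code of an induced subgraph a subword of the code of `G`:
some rows and columns are deleted. One pass over the input therefore suffices to write it. -/
theorem graphCode_sub (G : SimpleGraph (Fin n)) (S : Set (Fin n)) :
    graphCode (sub G S) = (elems S).flatMap (rowCode G (elems S)) := by
  have h : elems S = (List.finRange (elems S).length).map (elems S).get :=
    (List.map_get_finRange _).symm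
  conv_rhs => rw [h]
  rw [graphCode_eq, List.flatMap_map]
  refine congrArg (fun f => List.flatMap f _) (funext fun i => ?_)
  simp only [rowCode, List.map_map]
  rfl

end

variable {M : EnumMachine} {B n : ℕ} {s s' : St M}

/-! ### Loading an induced subgraph -/

/-- Write the code of the subgraph induced by `cur` on the input stack of the simulated machine. -/
def build : Pr M :=
  .seq (pour .inp .word id) <| .seq (pour .word .copy id) <| .seq (clear .word) <|
  .seq (.forEach (.inr .cur) fun r =>
    .seq (.forEach (.inr .cur) fun c => .pop (.inr .copy) fun o =>
        bif r && c then .push (.inr .word) fun _ => o.getD none else skip)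
      (.pop (.inr .copy) fun _ => bif r then .push (.inr .word) fun _ => none else skip)) <|
  .seq (.forEach (.inr .word) fun c => .push (.inl M.k₀) fun _ => M.inputAlphabet.symm c)
    (clear .word)

/-- Symbols are popped from `copy` even in deleted rows and columns, which keeps `copy` aligned with
`cur`. -/
theorem exLoop_columns (S : Set (Fin n)) (r : Bool) (f : Fin n → Option Bool)
    (rest : List (Option Bool)) : ∀ (xs : List (Fin n)) (s : St M), s.copy = xs.map f ++ rest →
    ExLoop B (fun c => .pop (.inr .copy) fun o =>
        bif r && c then .push (.inr .word) fun _ => o.getD none else skip : Bool → Pr M)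
      (xs.map (ind S)) s
      { s with
        copy := rest
        word := (bif r then (xs.filter (ind S)).map f else []).reverse ++ s.word }
  | [], s, h => by
    simp only [List.map_nil, List.nil_append] at h
    subst h
    cases r <;> exact .nil
  | x :: xs, s, h => by
    refine .cons (.pop (s' := { s with
        copy := xs.map f ++ rest
        word := (bif r && ind S x then [f x] else []) ++ s.word }) ?_) ?_
    · change Ex B (bif r && ind S x then .push (.inr .word) fun _ => s.copy.head?.getD none else skip)
        { s with copy := s.copy.tail } _
      rw [h]
      cases hr : r && ind S x
      · exact .skip
      · exact .push
    · refine .of_eq (exLoop_columns S r f rest xs _ rfl) ?_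
      cases r <;> cases hx : ind S x <;> simp [hx]

theorem exLoop_rows (G : SimpleGraph (Fin n)) (S : Set (Fin n)) (hn : n ≤ B) :
    ∀ (xs : List (Fin n)) (s : St M), s.cur = vertexSetCode S →
    s.copy = xs.flatMap (rowCode G (List.finRange n)) →
    ExLoop B (fun r => .seq (.forEach (.inr .cur) fun c => .pop (.inr .copy) fun o =>
        bif r && c then .push (.inr .word) fun _ => o.getD none else skip)
      (.pop (.inr .copy) fun _ => bif r then .push (.inr .word) fun _ => none else skip) :
        Bool → Pr M) (xs.map (ind S)) s
      { s with
        copy := []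
        word := ((xs.filter (ind S)).flatMap (rowCode G (elems S))).reverse ++ s.word }
  | [], s, hc, h => by
    simp only [List.flatMap_nil] at h
    have : s = { s with copy := [] } := by rw [← h]
    rw [this]
    exact .nil
  | x :: xs, s, hc, h => by
    classical
    have hcols := exLoop_columns (B := B) S (ind S x) (fun j => some (decide (G.Adj x j)))
      (none :: xs.flatMap (rowCode G (List.finRange n))) (List.finRange n) s
      (by rw [h]; simp [rowCode])
    refine .cons (s₁ := { s with
        copy := xs.flatMap (rowCode G (List.finRange n))
        word := (bif ind S x then rowCode G (elems S) x else []).reverse ++ s.word })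
      (.seq (s₁ := { s with
        copy := none :: xs.flatMap (rowCode G (List.finRange n))
        word := (bif ind S x then ((List.finRange n).filter (ind S)).map
          fun j => some (decide (G.Adj x j)) else []).reverse ++ s.word })
        (.forEach hc (by simpa using hn) hcols) (.pop ?_)) ?_
    · cases hx : ind S x
      · exact .skip
      · refine Ex.push.of_eq ?_
        simp [St.set, St.get, rowCode, elems]
    · refine .of_eq (exLoop_rows G S hn xs _ hc rfl) ?_
      cases hx : ind S x <;> simp [hx]

theorem exLoop_input : ∀ (l : List (Option Bool)) (s : St M),
    ExLoop B (fun c => .push (.inl M.k₀) fun _ => M.inputAlphabet.symm c : Option Bool → Pr M) l s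
      { s with mst := update s.mst M.k₀ ((l.map M.inputAlphabet.symm).reverse ++ s.mst M.k₀) }
  | [], s => by
    simpa using ExLoop.nil
  | c :: l, s => by
    refine .cons .pushM ?_
    refine .of_eq (exLoop_input l _) ?_
    simp

theorem initList_stk (w : List (M.Γ M.k₀)) :
    TM2.Cfg.stk (initList M.toFinTM2 w) = update (fun _ => []) M.k₀ w := by
  funext k
  by_cases h : k = M.k₀
  · subst h
    rw [update_self]
    exact dif_pos rfl
  · rw [update_of_ne h]
    exact dif_neg h

theorem Ex.build (G : SimpleGraph (Fin n)) (S : Set (Fin n)) (hn : n * (n + 1) ≤ B)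
    (hinp : s.inp = graphCode G) (hcur : s.cur = vertexSetCode S) (hw : s.word = [])
    (hc : s.copy = []) (hm : s.mst = fun _ => []) :
    Ex B build s { s with
      mst := TM2.Cfg.stk (initList M.toFinTM2 ((graphCode (sub G S)).map M.inputAlphabet.symm)) } := by
  have hB : (graphCode G).length ≤ B := by rwa [length_graphCode]
  have hn' : n ≤ B := by
    rcases n with _ | n
    · exact Nat.zero_le _
    · exact (Nat.le_mul_of_pos_right _ (Nat.succ_pos _)).trans hn
  have hlen : (graphCode (sub G S)).length ≤ B := by
    rw [length_graphCode]
    have : (elems S).length ≤ n := by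
      simpa [elems] using List.length_filter_le (ind S) (List.finRange n)
    exact (Nat.mul_le_mul this (Nat.succ_le_succ this)).trans hn
  -- Pouring does not consume its source, so `inp` survives; the second pour restores the order on
  -- `copy`. The selected symbols are again collected in reverse on `word`, which the final transfer
  -- to the input stack undoes.
  refine .seq (s₁ := { s with word := (graphCode G).reverse }) ((Ex.pour ?_).of_eq ?_) ?_
  · simpa [St.get, hinp] using hB
  · simp [St.set, St.get, hinp, hw]
  refine .seq (s₁ := { s with word := (graphCode G).reverse, copy := graphCode G })
    ((Ex.pour ?_).of_eq ?_) ?_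
  · simpa [St.get] using hB
  · simp [St.set, St.get, hc]
  refine .seq (s₁ := { s with copy := graphCode G }) ((Ex.clear ?_).of_eq ?_) ?_
  · simpa [St.get] using hB
  · simp [St.set, hw]
  refine .seq (s₁ := { s with word := (graphCode (sub G S)).reverse }) (.forEach hcur ?_ ?_) ?_
  · simpa using hn'
  · refine .of_eq (exLoop_rows G S hn' (List.finRange n) { s with copy := graphCode G } hcur rfl) ?_
    have h1 : ((List.finRange n).filter (ind S)).flatMap (rowCode G (elems S)) =
      graphCode (sub G S) := (graphCode_sub G S).symm
    rw [h1]
    simp [hcur, hw, hc, vertexSetCode_eq]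
  refine .seq (s₁ := { s with
    word := (graphCode (sub G S)).reverse,
    mst := TM2.Cfg.stk (initList M.toFinTM2 ((graphCode (sub G S)).map M.inputAlphabet.symm)) })
    (.forEach rfl ?_ ?_) ?_
  · simpa [St.get] using hlen
  · refine .of_eq (exLoop_input _ _) ?_
    simp [St.get, initList_stk, hm]
  · refine (Ex.clear ?_).of_eq ?_
    · simpa [St.get] using hlen
    · simp [St.set, hw]

/-! ### Simulated runs -/

/-- The configuration after `t` steps, where a halting configuration is repeated. -/
def simCfg (M : EnumMachine) (w : List (Option Bool)) (t : ℕ) : TM2.Cfg M.Γ M.Λ M.σ :=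
  (simStep M)^[t] (initList M.toFinTM2 (w.map M.inputAlphabet.symm))

/-- The words emitted in the configurations `0, …, t - 1`. -/
def emissions (M : EnumMachine) (w : List (Option Bool)) (t : ℕ) : List (List Bool) :=
  (List.range t).filterMap fun u => M.emitted (simCfg M w u)

theorem emissions_succ (w : List (Option Bool)) (t : ℕ) :
    emissions M w (t + 1) = emissions M w t ++ (M.emitted (simCfg M w t)).toList := by
  rw [emissions, List.range_succ, List.filterMap_append]
  cases h : M.emitted (simCfg M w t) <;> simp [emissions, h]

/-- A stack of recorded words, in the order of emission from bottom to top, every word being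
reversed and followed by a separator. -/
def record (xs : List (List Bool)) : List (Option Bool) :=
  xs.reverse.flatMap fun x => x.reverse.map some ++ [none]

theorem record_append (xs ys : List (List Bool)) : record (xs ++ ys) = record ys ++ record xs := by
  simp [record]

/-- Record the output word of the simulated machine. -/
def recordM (collect : Bool) : Pr M :=
  .seq (bif collect then .push (.inr .res) fun _ => none else skip) <|
  .seq (.forEach (.inl M.k₁) fun a =>
    .seq (bif collect then .push (.inr .res) fun _ => some (M.outputAlphabet a) else skip)
      (bif M.outputAlphabet a then skip else .load fun c => { c with good := false }))
    (.load fun c => { c with full := c.full || c.good, good := true })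

theorem exLoop_record (collect : Bool) : ∀ (l : List (M.Γ M.k₁)) (s : St M),
    ExLoop B (fun a => .seq
      (bif collect then .push (.inr .res) fun _ => some (M.outputAlphabet a) else skip)
      (bif M.outputAlphabet a then skip else .load fun c => { c with good := false }) :
        M.Γ M.k₁ → Pr M) l s
      { s with
        ctl := { s.ctl with good := s.ctl.good && (l.map M.outputAlphabet).all id }
        res := (bif collect then (l.map M.outputAlphabet).reverse.map some else []) ++ s.res }
  | [], s => by
    cases collect <;> simpa using ExLoop.nil
  | a :: l, s => by
    refine .cons (s₁ := { s with
        ctl := { s.ctl with good := s.ctl.good && M.outputAlphabet a }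
        res := (bif collect then [some (M.outputAlphabet a)] else []) ++ s.res })
      (.seq (s₁ := { s with
        res := (bif collect then [some (M.outputAlphabet a)] else []) ++ s.res }) ?_ ?_) ?_
    · cases collect
      · exact .skip
      · exact .push
    · cases h : M.outputAlphabet a
      · exact Ex.load.of_eq (by simp)
      · exact Ex.skip.of_eq (by simp)
    · refine .of_eq (exLoop_record collect l _) ?_
      cases collect <;> simp [Bool.and_assoc]

theorem Ex.recordM {collect : Bool} (hB : (s.mst M.k₁).length ≤ B) (hg : s.ctl.good = true) :
    Ex B (recordM collect) s { s with
      ctl := { s.ctl with full := s.ctl.full || ((s.mst M.k₁).map M.outputAlphabet).all id }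
      res := (bif collect then record [(s.mst M.k₁).map M.outputAlphabet] else []) ++ s.res } := by
  refine .seq (s₁ := { s with res := (bif collect then [none] else []) ++ s.res }) ?_ <|
    .seq (.forEachM hB (exLoop_record collect _ _)) (Ex.load.of_eq ?_)
  · cases collect
    · exact .skip
    · exact .push
  · cases collect <;> simp [hg, record]

/-- Run the machine on the subgraph induced by `cur` within the given budget. The flag `halted`
tells whether it halted, the flag `full` whether it emitted a word without `false`; if `collect` is
set, the emitted words are recorded on the stack `res`. -/
noncomputable def run (collect : Bool) : Pr M :=
  .seq build <|
  .seq (.load fun c => { c with lab := some M.main, mv := M.initialState, full := false }) <|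
  .seq (.forEach (.inr .budget) fun _ =>
    .seq (.ite (fun c => c.lab.elim false M.emit) (recordM collect) skip) stepM) <|
  .seq (.load fun c => { c with halted := c.lab.isNone }) <|
  .seq clearAllM (.load fun c => { c with lab := none, mv := M.initialState })

/-- The simulated machine is reset and the scratch stacks of `run` are empty. -/
structure Idle (s : St M) : Prop where
  lab : s.ctl.lab = none
  mv : s.ctl.mv = M.initialState
  good : s.ctl.good = true
  mst : s.mst = fun _ => []
  word : s.word = []
  copy : s.copy = []

theorem Ex.run {G : SimpleGraph (Fin n)} {S : Set (Fin n)} {T : ℕ} (collect : Bool)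
    (hn : n * (n + 1) ≤ B) (hT : T ≤ B)
    (hst : ∀ t ≤ T, ∀ k, ((simCfg M (graphCode (sub G S)) t).stk k).length ≤ B)
    (hs : Idle s) (hinp : s.inp = graphCode G) (hcur : s.cur = vertexSetCode S)
    (hb : s.budget = List.replicate T ()) :
    Ex B (run collect) s { s with
      ctl := { s.ctl with
        full := (emissions M (graphCode (sub G S)) T).any (·.all id)
        halted := (simCfg M (graphCode (sub G S)) T).l.isNone }
      res := (bif collect then record (emissions M (graphCode (sub G S)) T) else []) ++ s.res } := by
  set w := graphCode (sub G S) with hw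
  -- Loop invariant: the simulated machine is in its configuration after `t` steps, and the
  -- emissions of the configurations before it have been recorded. Configuration `T` itself is not
  -- inspected; if it is halted, it emits nothing.
  let I : ℕ → St M := fun t => { s with
    ctl := { s.ctl with
      lab := (simCfg M w t).l
      mv := (simCfg M w t).var
      full := (emissions M w t).any (·.all id) }
    mst := (simCfg M w t).stk
    res := (bif collect then record (emissions M w t) else []) ++ s.res }
  refine .seq (.build G S hn hinp hcur hs.word hs.copy hs.mst) ?_
  refine .seq (s₁ := I 0) (Ex.load.of_eq ?_) ?_
  · cases collect <;> simp [I, simCfg, emissions, record, hw, initList]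
  refine .seq (s₁ := I T) (.forEach hb (by simpa using hT) ?_) ?_
  · refine .of_eq (ExLoop.of_index (I := I) ?_) (by simp)
    intro t ht
    have ht : t < T := by simpa using ht
    have hemit : M.emitted (simCfg M w t) = match (simCfg M w t).l with
      | none => none
      | some l => if M.emit l then some (((simCfg M w t).stk M.k₁).map M.outputAlphabet)
        else none := rfl
    refine .seq (s₁ := { I t with
      ctl := { (I t).ctl with full := (emissions M w (t + 1)).any (·.all id) }
      res := (bif collect then record (emissions M w (t + 1)) else []) ++ s.res })
      (.ite (fun h => ?_) fun h => ?_) (Ex.stepM.of_eq ?_)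
    · have h : (simCfg M w t).l.elim false M.emit = true := h
      refine (Ex.recordM (s := I t) (hst t ht.le _) hs.good).of_eq ?_
      rw [emissions_succ, hemit]
      cases hl : (simCfg M w t).l with
      | none => simp [hl] at h
      | some l =>
        have hl' : M.emit l = true := by simpa [hl] using h
        cases collect <;> simp [I, hl, hl', record_append]
    · have h : (simCfg M w t).l.elim false M.emit = false := h
      refine Ex.skip.of_eq ?_
      rw [emissions_succ, hemit]
      cases hl : (simCfg M w t).l with
      | none => simp [I, hl]
      | some l =>
        have hl' : M.emit l = false := by simpa [hl] using h
        simp [I, hl, hl']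
    · have h : simCfg M w (t + 1) = simStep M (simCfg M w t) := iterate_succ_apply' _ _ _
      simp only [I, h]
      rfl
  refine .seq .load <| .seq (.clearAllM fun k => hst T le_rfl k) (Ex.load.of_eq ?_)
  simp [I, hs.lab, hs.mv, hs.mst]

end

section

/-! ### Hereditary classes -/

section

variable {P : GraphClass}

theorem isSetOf_comap {V W : Type} [Finite V] [Finite W] (G : SimpleGraph W) {f : V → W}
    (hf : Injective f) (U : Set V) :
    P.IsSetOf (G.comap f) U ↔ P.IsSetOf G (f '' U) := by
  have e : (G.comap f).induce U ≃g G.induce (f '' U) :=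
    { toEquiv := Equiv.Set.image f U hf
      map_rel_iff' := by intro a b; rfl }
  exact ⟨P.iso_closed _ _ ⟨e⟩, P.iso_closed _ _ ⟨e.symm⟩⟩

theorem _root_.GraphClass.Hereditary.isSetOf_mono (hP : P.Hereditary) {V : Type} [Finite V]
    {G : SimpleGraph V} {U W : Set V} (hW : P.IsSetOf G W) (hU : U.Nonempty) (h : U ⊆ W) :
    P.IsSetOf G U := by
  have h₁ := hP (G.induce W) (Subtype.val ⁻¹' U) (by
    obtain ⟨x, hx⟩ := hU
    exact ⟨⟨x, h hx⟩, hx⟩) hW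
  have h₂ : P.IsSetOf (G.comap (Subtype.val : W → V)) (Subtype.val ⁻¹' U) := h₁
  rw [isSetOf_comap G Subtype.val_injective, Subtype.image_preimage_coe,
    Set.inter_eq_right.2 h] at h₂
  exact h₂

end

/-! ### Induced subgraphs, coverings and the bound for the number of solutions -/

section

variable {P : GraphClass} {n : ℕ} {G : SimpleGraph (Fin n)}

theorem mem_elems {S : Set (Fin n)} {v : Fin n} : v ∈ elems S ↔ v ∈ S := by
  simp [elems, ind_eq_true]

theorem get_elems_injective (S : Set (Fin n)) : Injective (elems S).get :=
  List.nodup_iff_injective_get.1 ((List.nodup_finRange n).filter _)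

theorem range_get_elems (S : Set (Fin n)) : Set.range (elems S).get = S := by
  ext v
  rw [Set.mem_range, ← List.mem_iff_get, mem_elems]

theorem length_elems_le (S : Set (Fin n)) : (elems S).length ≤ n := by
  simpa [elems] using List.length_filter_le (ind S) (List.finRange n)

theorem vertexSetCode_injective : Injective (vertexSetCode (n := n)) := by
  intro U W h
  have := List.map_inj_left.1 h
  ext v
  rw [← ind_eq_true, ← ind_eq_true]
  exact iff_of_eq (congrArg (· = true) (this v (List.mem_finRange v)))

theorem all_vertexSetCode {U : Set (Fin n)} : (vertexSetCode U).all id = true ↔ U = Set.univ := by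
  simp [vertexSetCode_eq, Set.eq_univ_iff_forall, ind_eq_true]

/-- The set of vertices of `G` that corresponds to a set of vertices of an induced subgraph. -/
noncomputable def lift (S : Set (Fin n)) (U : Set (Fin (elems S).length)) : Set (Fin n) :=
  (elems S).get '' U

theorem lift_subset (S : Set (Fin n)) (U : Set (Fin (elems S).length)) : lift S U ⊆ S := by
  conv_rhs => rw [← range_get_elems S]
  exact Set.image_subset_range _ _

theorem isSetOf_sub {S : Set (Fin n)} {U : Set (Fin (elems S).length)} :
    P.IsSetOf (sub G S) U ↔ P.IsSetOf G (lift S U) :=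
  isSetOf_comap G (get_elems_injective S) U

theorem isSetOf_sub_univ {S : Set (Fin n)} :
    P.IsSetOf (sub G S) Set.univ ↔ P.IsSetOf G S := by
  rw [isSetOf_sub, lift, Set.image_univ, range_get_elems]

theorem lift_preimage (S Z : Set (Fin n)) : lift S ((elems S).get ⁻¹' Z) = Z ∩ S := by
  rw [lift, Set.image_preimage_eq_inter_range, range_get_elems]

theorem exists_isMaximalSetOf {V : Type} [Finite V] {H : SimpleGraph V} {U : Set V}
    (hU : P.IsSetOf H U) : ∃ W, U ⊆ W ∧ P.IsMaximalSetOf H W := by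
  obtain ⟨W, hUW, hW⟩ := Set.Finite.exists_le_maximal (Set.toFinite {W : Set V | P.IsSetOf H W}) hU
  exact ⟨W, hUW, hW.1, fun Z hZ h => hZ.not_subset (hW.2 h hZ.subset)⟩

/-- Every `P` set inside `A` lies in a member of `L`. -/
def Covers (P : GraphClass) (G : SimpleGraph (Fin n)) (L : List (Set (Fin n))) (A : Set (Fin n)) :
    Prop :=
  ∀ W ⊆ A, P.IsSetOf G W → ∃ Z ∈ L, W ⊆ Z

theorem Covers.mono {L L' : List (Set (Fin n))} {A A' : Set (Fin n)} (h : Covers P G L A)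
    (hL : L ⊆ L') (hA : A' ⊆ A) : Covers P G L' A' := fun W hW hPW => by
  obtain ⟨Z, hZ, hWZ⟩ := h W (hW.trans hA) hPW
  exact ⟨Z, hL hZ, hWZ⟩

/-- Every `P` set inside `S` extends to a maximal one of `G[S]`, so only those have to be checked.
-/
theorem covers_of_isMaximalSetOf_sub {L : List (Set (Fin n))} {S : Set (Fin n)}
    (h : ∀ U, P.IsMaximalSetOf (sub G S) U → ∃ Z ∈ L, lift S U ⊆ Z) : Covers P G L S := by
  intro W hW hPW
  have : lift S ((elems S).get ⁻¹' W) = W := by rw [lift_preimage, Set.inter_eq_left.2 hW]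
  obtain ⟨U, hU, hmax⟩ := exists_isMaximalSetOf (isSetOf_sub.2 (this.symm ▸ hPW))
  obtain ⟨Z, hZ, hUZ⟩ := h U hmax
  refine ⟨Z, hZ, ?_⟩
  rw [← this]
  exact (Set.image_mono hU).trans hUZ

/-- If all `P` sets inside the graphs `G[K \ {v}]` are covered and `G[K]` is not in the class, then
`G[K]` has at most as many solutions as there are covering sets. -/
theorem numSolutions_sub_le (hP : P.Hereditary) {L : List (Set (Fin n))} {K : Set (Fin n)}
    (hL : ∀ Z ∈ L, P.IsSetOf G Z) (hK : ¬ P.IsSetOf G K)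
    (h : ∀ v ∈ K, Covers P G L (K \ {v})) : P.numSolutions (sub G K) ≤ L.length := by
  classical
  have hsub : {U | P.IsMaximalSetOf (sub G K) U} ⊆
      (fun Z => (elems K).get ⁻¹' Z) '' (L.toFinset : Set (Set (Fin n))) := by
    -- `U` is the trace on `K` of a member of `L`. It is not all of `K`, because `G[K]` is not in
    -- the class; a missing vertex `v` provides a covering `Z`.
    intro U hU
    have hPU := isSetOf_sub.1 hU.1
    have hne : ¬ K ⊆ lift K U := fun hKU =>
      hK ((Set.Subset.antisymm (lift_subset K U) hKU) ▸ hPU)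
    obtain ⟨v, hvK, hv⟩ := Set.not_subset.1 hne
    obtain ⟨Z, hZ, hUZ⟩ := h v hvK (lift K U)
      (fun x hx => ⟨lift_subset K U hx, fun hxv => hv (hxv ▸ hx)⟩) hPU
    refine ⟨Z, by simpa using hZ, ?_⟩
    have hUZ' : U ⊆ (elems K).get ⁻¹' Z := Set.image_subset_iff.1 hUZ
    by_contra hne
    have hss := hUZ'.ssubset_of_ne (Ne.symm hne)
    refine hU.2 _ hss (isSetOf_sub.2 ?_)
    -- The trace `Z ∩ K` would be a larger `P` set. Heredity speaks of nonempty sets only; the trace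
    -- is nonempty since it properly contains `U`.
    refine hP.isSetOf_mono (hL Z hZ) ?_ (by rw [lift_preimage]; exact Set.inter_subset_left)
    obtain ⟨x, hx, -⟩ := Set.exists_of_ssubset hss
    exact ⟨_, x, hx, rfl⟩
  calc P.numSolutions (sub G K) ≤ _ := Set.ncard_le_ncard hsub (Set.toFinite _)
    _ ≤ (L.toFinset : Set (Set (Fin n))).ncard := Set.ncard_image_le (Set.toFinite _)
    _ ≤ L.length := by
      rw [Set.ncard_coe_finset]
      exact L.toFinset_card_le

/-- The only solution of a graph in the class is the whole vertex set. -/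
theorem numSolutions_of_mem {V : Type} [Finite V] {H : SimpleGraph V}
    (h : P.IsSetOf H Set.univ) : P.numSolutions H = 1 := by
  have : {U | P.IsMaximalSetOf H U} = {Set.univ} := by
    ext U
    refine ⟨fun hU => ?_, ?_⟩
    · by_contra hne
      exact hU.2 _ ((Set.subset_univ U).ssubset_of_ne hne) h
    · rintro rfl
      exact ⟨h, fun W hW => absurd (Set.subset_univ W) hW.2⟩
  rw [GraphClass.numSolutions, this, Set.ncard_singleton]

theorem isMaximalSetOf_univ {V : Type} [Finite V] {H : SimpleGraph V}
    (h : P.IsSetOf H Set.univ) : P.IsMaximalSetOf H Set.univ :=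
  ⟨h, fun W hW => absurd (Set.subset_univ W) hW.2⟩

/-! ### Greedy extension -/

open Classical in
/-- Add to `U` those of the first `i` vertices that can be added greedily. -/
noncomputable def grow (P : GraphClass) (G : SimpleGraph (Fin n)) (U : Set (Fin n)) : ℕ → Set (Fin n)
  | 0 => U
  | i + 1 => if h : i < n then
      if P.IsSetOf G (insert ⟨i, h⟩ (grow P G U i)) then insert ⟨i, h⟩ (grow P G U i)
      else grow P G U i
    else grow P G U i

/-- The greedy extension of a `P` set to a maximal one. -/
noncomputable def extend (P : GraphClass) (G : SimpleGraph (Fin n)) (U : Set (Fin n)) :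
    Set (Fin n) := grow P G U n

theorem grow_succ {U : Set (Fin n)} (i : Fin n) [Decidable (P.IsSetOf G (insert i (grow P G U i)))] :
    grow P G U (i + 1) = if P.IsSetOf G (insert i (grow P G U i)) then insert i (grow P G U i)
      else grow P G U i := by
  rw [grow, dif_pos i.2]
  congr

/-- Vertices not yet considered still have their original status, so the unread part of the vector
of `U` is also that of the current set. -/
theorem mem_grow_of_le {U : Set (Fin n)} : ∀ {i : ℕ} {v : Fin n}, i ≤ v →
    (v ∈ grow P G U i ↔ v ∈ U)
  | 0, v, _ => Iff.rfl
  | i + 1, v, h => by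
    classical
    have ih := mem_grow_of_le (U := U) (i := i) (v := v) (by omega)
    rw [grow_succ ⟨i, by omega⟩]
    split_ifs
    · rw [Set.mem_insert_iff, ih, or_iff_right]
      intro he
      have := congrArg Fin.val he
      simp only at this
      omega
    · exact ih

theorem grow_mono {U : Set (Fin n)} : Monotone (grow P G U) := by
  refine monotone_nat_of_le_succ fun i => ?_
  rw [grow]
  split_ifs
  · exact Set.subset_insert _ _
  · exact le_rfl
  · exact le_rfl

theorem isSetOf_grow {U : Set (Fin n)} (hU : P.IsSetOf G U) : ∀ i, P.IsSetOf G (grow P G U i)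
  | 0 => hU
  | i + 1 => by
    rw [grow]
    split_ifs with h h'
    · exact h'
    · exact isSetOf_grow hU i
    · exact isSetOf_grow hU i

theorem subset_extend (U : Set (Fin n)) : U ⊆ extend P G U := grow_mono (Nat.zero_le n)

/-- Suppose a larger `P` set contains a further vertex `v`. When `v` was considered, the current set
with `v` added lay inside that `P` set, so by heredity it was a `P` set and `v` was added. -/
theorem isMaximalSetOf_extend (hP : P.Hereditary) {U : Set (Fin n)} (hU : P.IsSetOf G U) :
    P.IsMaximalSetOf G (extend P G U) := by
  classical
  refine ⟨isSetOf_grow hU n, fun W hW hPW => ?_⟩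
  obtain ⟨v, hvW, hv⟩ := Set.exists_of_ssubset hW
  have h₁ : insert v (grow P G U v) ⊆ W :=
    Set.insert_subset hvW ((grow_mono v.2.le).trans hW.subset)
  have h₂ := hP.isSetOf_mono hPW (Set.insert_nonempty _ _) h₁
  have h₃ := grow_succ (P := P) (G := G) (U := U) v
  rw [if_pos h₂] at h₃
  refine hv ((grow_mono (P := P) (G := G) (U := U) v.2) ?_)
  show v ∈ grow P G U (v + 1)
  rw [h₃]
  exact Set.mem_insert _ _

end

/-! ### Simulated runs of an enumeration machine -/

section

variable {M : EnumMachine} {w : List (Option Bool)}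

theorem simStep_of_halted {c : TM2.Cfg M.Γ M.Λ M.σ} (h : c.l = none) : simStep M c = c := by
  obtain ⟨l, v, S⟩ := c
  obtain rfl : l = none := h
  rfl

theorem simCfg_succ (t : ℕ) : simCfg M w (t + 1) = simStep M (simCfg M w t) :=
  iterate_succ_apply' _ _ _

theorem simCfg_of_halted {t : ℕ} (h : (simCfg M w t).l = none) {u : ℕ} (hu : t ≤ u) :
    simCfg M w u = simCfg M w t := by
  induction u, hu using Nat.le_induction with
  | base => rfl
  | succ u _ ih => rw [simCfg_succ, ih, simStep_of_halted h]

/-- `cfgAt` is undefined after a halt, whereas the total function `simCfg` stays there. They differ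
only where nothing is emitted. -/
theorem cfgAt_simCfg : ∀ t : ℕ, M.cfgAt w t = some (simCfg M w t) ∨
    (M.cfgAt w t = none ∧ (simCfg M w t).l = none)
  | 0 => .inl rfl
  | t + 1 => by
    rcases cfgAt_simCfg t with h | ⟨h, h'⟩
    · rw [simCfg_succ, EnumMachine.cfgAt, h]
      generalize simCfg M w t = c
      obtain ⟨_ | l, v, S⟩ := c
      · exact .inr ⟨rfl, rfl⟩
      · exact .inl rfl
    · refine .inr ⟨by rw [EnumMachine.cfgAt, h]; rfl, ?_⟩
      rw [simCfg_succ, simStep_of_halted h', h']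

theorem bind_emitted (t : ℕ) : (M.cfgAt w t).bind M.emitted = M.emitted (simCfg M w t) := by
  rcases cfgAt_simCfg (M := M) (w := w) t with h | ⟨h, h'⟩
  · rw [h]; rfl
  · rw [h]
    generalize simCfg M w t = c at h'
    obtain ⟨l, v, S⟩ := c
    obtain rfl : l = none := h'
    rfl

/-- The shift arises because `outputs` includes configuration `t` and `emissions` stops before it.
-/
theorem outputs_eq (t : ℕ) : M.outputs w t = emissions M w (t + 1) :=
  List.filterMap_congr fun _ _ => bind_emitted _

theorem mem_emissions {x : List Bool} {t : ℕ} :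
    x ∈ emissions M w t ↔ ∃ u < t, M.emitted (simCfg M w u) = some x := by
  simp [emissions]

theorem lt_of_emitted {x : List Bool} {u t : ℕ} (ht : (simCfg M w t).l = none)
    (h : M.emitted (simCfg M w u) = some x) : u < t := by
  by_contra hu
  rw [simCfg_of_halted ht (not_lt.1 hu)] at h
  generalize simCfg M w t = c at h ht
  obtain ⟨l, v, S⟩ := c
  obtain rfl : l = none := ht
  simp [EnumMachine.emitted] at h

theorem halted_of_haltsWithin {t : ℕ} (h : M.HaltsWithin w t) : (simCfg M w t).l = none := by
  obtain ⟨u, hu, c, hc, hl⟩ := h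
  rcases cfgAt_simCfg (M := M) (w := w) u with h | ⟨h, _⟩
  · have h : c = simCfg M w u := Option.some.inj (hc.symm.trans h)
    rw [simCfg_of_halted (h ▸ hl) hu, ← h, hl]
  · simp [hc] at h

theorem length_emissions_le (t : ℕ) : (emissions M w t).length ≤ t := by
  simpa [emissions] using List.length_filterMap_le (fun u => M.emitted (simCfg M w u)) (List.range t)

variable {P : GraphClass} {m t : ℕ} {H : SimpleGraph (Fin m)}

/-- All emissions precede any time at which the machine has halted, so a run seen to halt at `T` is
complete, however `T` compares with `t`. -/
theorem mem_emissions_iff (hM : M.EnumeratesWithin P H t) {T : ℕ}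
    (hT : (simCfg M (graphCode H) T).l = none) (x : List Bool) :
    x ∈ emissions M (graphCode H) T ↔ ∃ U, P.IsMaximalSetOf H U ∧ vertexSetCode U = x := by
  have ht := halted_of_haltsWithin hM.1
  rw [← hM.2.2 x, outputs_eq, mem_emissions, mem_emissions]
  refine ⟨fun ⟨u, _, hx⟩ => ⟨u, (lt_of_emitted ht hx).trans (Nat.lt_succ_self t), hx⟩,
    fun ⟨u, _, hx⟩ => ⟨u, lt_of_emitted hT hx, hx⟩⟩

/-- This needs no halting at `T`: the words of an interrupted run are usable as well. -/
theorem isMaximalSetOf_of_mem_emissions (hM : M.EnumeratesWithin P H t) {T : ℕ} {x : List Bool}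
    (hx : x ∈ emissions M (graphCode H) T) : ∃ U, P.IsMaximalSetOf H U ∧ vertexSetCode U = x := by
  rw [← mem_emissions_iff hM (halted_of_haltsWithin hM.1), mem_emissions]
  obtain ⟨u, _, hu⟩ := mem_emissions.1 hx
  exact ⟨u, lt_of_emitted (halted_of_haltsWithin hM.1) hu, hu⟩

/-- The membership test. The all-ones word codes a solution only if the whole graph is in the class,
even in an interrupted run; conversely, halting is needed only for graphs in the class. -/
theorem emissions_any_all (hM : M.EnumeratesWithin P H t) {T : ℕ}
    (hT : P.IsSetOf H Set.univ → (simCfg M (graphCode H) T).l = none) :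
    (emissions M (graphCode H) T).any (·.all id) = true ↔ P.IsSetOf H Set.univ := by
  rw [List.any_eq_true]
  constructor
  · rintro ⟨x, hx, hall⟩
    obtain ⟨U, hU, rfl⟩ := isMaximalSetOf_of_mem_emissions hM hx
    rw [all_vertexSetCode.1 hall] at hU
    exact hU.1
  · intro h
    exact ⟨_, (mem_emissions_iff hM (hT h) _).2 ⟨_, isMaximalSetOf_univ h, rfl⟩,
      all_vertexSetCode.2 rfl⟩

/-- The emissions of an enumeration machine are codes of solutions. -/
theorem exists_map_eq_emissions (hM : M.EnumeratesWithin P H t) (T : ℕ) :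
    ∃ Us : List (Set (Fin m)), emissions M (graphCode H) T = Us.map vertexSetCode ∧
      ∀ U ∈ Us, P.IsMaximalSetOf H U := by
  have key : ∀ l : List (List Bool), (∀ x ∈ l, ∃ U, P.IsMaximalSetOf H U ∧ vertexSetCode U = x) →
      ∃ Us : List (Set (Fin m)), l = Us.map vertexSetCode ∧ ∀ U ∈ Us, P.IsMaximalSetOf H U := by
    intro l
    induction l with
    | nil => exact fun _ => ⟨[], rfl, by simp⟩
    | cons x l ih =>
      intro h
      obtain ⟨U, hU, hx⟩ := h x (by simp)
      obtain ⟨Us, hl, hUs⟩ := ih fun y hy => h y (by simp [hy])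
      exact ⟨U :: Us, by simp [hx, hl], by simpa [hU] using hUs⟩
  exact key _ fun x hx => isMaximalSetOf_of_mem_emissions hM hx

end

/-! ### Growth of the stacks of a machine -/

section

variable {M : EnumMachine}

/-- The number of pushes in a statement. -/
def pushes {J : Type} {Δ : J → Type} {Λ τ : Type} : TM2.Stmt Δ Λ τ → ℕ
  | .push _ _ q => pushes q + 1
  | .peek _ _ q => pushes q
  | .pop _ _ q => pushes q
  | .load _ q => pushes q
  | .branch _ p q => pushes p + pushes q
  | .goto _ => 0
  | .halt => 0

theorem length_stepAux_le {J : Type} [DecidableEq J] {Δ : J → Type} {Λ τ : Type} {b : ℕ} :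
    ∀ (q : TM2.Stmt Δ Λ τ) (v : τ) (S : ∀ j, List (Δ j)), (∀ j, (S j).length ≤ b) →
      ∀ j, ((TM2.stepAux q v S).stk j).length ≤ b + pushes q
  | .push k f q, v, S, h, j => by
    have := length_stepAux_le (b := b + 1) q v (update S k (f v :: S k)) (fun i => by
      by_cases hi : i = k
      · subst hi; simpa using h i
      · rw [update_of_ne hi]; exact (h i).trans (Nat.le_succ b)) j
    simp only [TM2.stepAux, pushes]
    omega
  | .peek k f q, v, S, h, j => length_stepAux_le q _ S h j
  | .pop k f q, v, S, h, j => by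
    refine length_stepAux_le q _ _ (fun i => ?_) j
    by_cases hi : i = k
    · subst hi
      rw [update_self, List.length_tail]
      exact (Nat.sub_le _ _).trans (h i)
    · rw [update_of_ne hi]; exact h i
  | .load f q, v, S, h, j => length_stepAux_le q _ S h j
  | .branch f p q, v, S, h, j => by
    have h₁ := length_stepAux_le p v S h j
    have h₂ := length_stepAux_le q v S h j
    simp only [TM2.stepAux, pushes]
    cases f v <;> simp only [cond_true, cond_false] <;> omega
  | .goto f, v, S, h, j => h j
  | .halt, v, S, h, j => h j

/-- A bound for the growth of the stacks of a machine in one step. -/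
def growth (M : EnumMachine) : ℕ := ∑ l ∈ M.ΛFin.elems, pushes (M.m l)

theorem length_simStep_le {b : ℕ} {c : TM2.Cfg M.Γ M.Λ M.σ} (h : ∀ k, (c.stk k).length ≤ b) (k : M.K) :
    ((simStep M c).stk k).length ≤ b + growth M := by
  obtain ⟨_ | l, v, S⟩ := c
  · exact (h k).trans (Nat.le_add_right _ _)
  · refine (length_stepAux_le (M.m l) v S h k).trans (Nat.add_le_add_left ?_ b)
    exact Finset.single_le_sum (f := fun l => pushes (M.m l)) (fun _ _ => Nat.zero_le _)
      (M.ΛFin.complete l)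

theorem length_simCfg_le (w : List (Option Bool)) (t : ℕ) (k : M.K) :
    ((simCfg M w t).stk k).length ≤ w.length + t * growth M := by
  induction t generalizing k with
  | zero =>
    change (TM2.Cfg.stk (initList M.toFinTM2 _) k).length ≤ _
    rw [initList_stk]
    by_cases h : k = M.k₀
    · subst h; simp
    · rw [update_of_ne h]; simp
  | succ t ih =>
    rw [simCfg_succ, Nat.succ_mul, ← Nat.add_assoc]
    exact length_simStep_le ih k

end

end

section

/-! ### The states between the procedures -/

section

variable {n : ℕ}

/-- The word in which a list of sets of vertices is stored. -/
noncomputable def solsCode (L : List (Set (Fin n))) : List (Option Bool) :=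
  L.flatMap fun Z => (vertexSetCode Z).map some ++ [none]

theorem length_solsCode (L : List (Set (Fin n))) : (solsCode L).length = L.length * (n + 1) := by
  simp [solsCode, List.length_flatMap]

/-- The data that vary during an iteration of the main loop. -/
structure Data (n : ℕ) where
  arg : List Bool := []
  block : List Bool := []
  left : List Bool := []
  right : List Bool := []
  outerLeft : List Bool := []
  outerRight : List Bool := []
  out : List Bool := []
  res : List (Option Bool) := []
  sols : List (Set (Fin n)) := []
  solved : Bool := false
  finished : Bool := false

/-- The state of the program with given graph, budget and data. -/
noncomputable def st (M : EnumMachine) (G : SimpleGraph (Fin n)) (T : ℕ) (d : Data n) : St M where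
  ctl := ⟨none, M.initialState, true, false, false, d.solved, false, false, d.finished⟩
  mst _ := []
  inp := graphCode G
  out := d.out
  budget := List.replicate T ()
  ones := List.replicate n true
  cur := []
  word := []
  copy := []
  res := d.res
  block := d.block
  arg := d.arg
  left := d.left
  right := d.right
  outerLeft := d.outerLeft
  outerRight := d.outerRight
  cmp := []
  tmp := []
  found := solsCode d.sols
  trace := (d.sols.map vertexSetCode).reverse

/-- The loops over the vertices keep a vector as a zipper: the decided bits, the current bit and the
undecided bits, which may come from different sets. -/
theorem take_append_drop_vertexSetCode {U V W : Set (Fin n)} {i : ℕ} (hi : i < n) {b : Bool}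
    (h₁ : ∀ j : Fin n, (j : ℕ) < i → (j ∈ W ↔ j ∈ U)) (h₂ : b = true ↔ (⟨i, hi⟩ : Fin n) ∈ W)
    (h₃ : ∀ j : Fin n, i < (j : ℕ) → (j ∈ W ↔ j ∈ V)) :
    (vertexSetCode U).take i ++ b :: (vertexSetCode V).drop (i + 1) = vertexSetCode W := by
  have ext' : ∀ {x y : Bool}, (x = true ↔ y = true) → x = y := by decide
  refine List.ext_getElem (by simp; omega) fun j hj hj' => ?_
  have hjn : j < n := by simpa using hj'
  rw [List.getElem_append]
  split_ifs with hji
  · have hji : j < i := by simp at hji; omega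
    simp only [vertexSetCode_eq, List.getElem_take, List.getElem_map, List.getElem_finRange]
    exact ext' (by rw [ind_eq_true, ind_eq_true]; exact (h₁ ⟨j, hjn⟩ hji).symm)
  · have hji : i ≤ j := by simp at hji; omega
    obtain ⟨k, rfl⟩ := Nat.exists_eq_add_of_le hji
    have : i + k - ((vertexSetCode U).take i).length = k := by simp; omega
    simp only [this]
    rcases k with _ | k
    · simp only [vertexSetCode_eq, List.getElem_map, List.getElem_finRange, List.getElem_cons_zero]
      exact ext' (by rw [ind_eq_true, h₂]; rfl)
    · have h := h₃ ⟨i + (k + 1), hjn⟩ (by simp)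
      have he : i + 1 + k = i + (k + 1) := by omega
      simp only [vertexSetCode_eq, List.getElem_cons_succ, List.getElem_drop, List.getElem_map,
        List.getElem_finRange]
      refine ext' ?_
      rw [ind_eq_true, ind_eq_true]
      simp only [he]
      exact h.symm

theorem take_succ_vertexSetCode {U V : Set (Fin n)} {i : ℕ} (hi : i < n)
    (h : ∀ j : Fin n, (j : ℕ) < i → (j ∈ V ↔ j ∈ U)) :
    (vertexSetCode V).take (i + 1) = (vertexSetCode U).take i ++ [ind V ⟨i, hi⟩] := by
  have h' := take_append_drop_vertexSetCode (U := U) (V := V) (W := V) hi (b := ind V ⟨i, hi⟩) h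
    ind_eq_true (fun _ _ => Iff.rfl)
  have := congrArg (List.take (i + 1)) h'
  rw [← this, ← List.singleton_append, ← List.append_assoc]
  refine List.take_left' ?_
  simp
  omega

theorem drop_vertexSetCode {U : Set (Fin n)} {i : ℕ} (hi : i < n) :
    (vertexSetCode U).drop i = ind U ⟨i, hi⟩ :: (vertexSetCode U).drop (i + 1) := by
  rw [List.drop_eq_getElem_cons (by simpa using hi)]
  simp [vertexSetCode_eq]

end

/-- What the iterations of the main loop with budget `T` need: the machine `M` solves the problem on
all induced subgraphs, halts within the budget on those in the class, and `B` is large enough. -/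
structure Fits (M : EnumMachine) (P : GraphClass) {n : ℕ} (G : SimpleGraph (Fin n)) (T B : ℕ) :
    Prop where
  enum : ∀ S, ∃ t, M.EnumeratesWithin P (sub G S) t
  halts : ∀ S, P.IsSetOf G S → (simCfg M (graphCode (sub G S)) T).l = none
  graph_le : n * (n + 1) ≤ B
  budget_le : T ≤ B
  stk_le : ∀ S, ∀ t ≤ T, ∀ k, ((simCfg M (graphCode (sub G S)) t).stk k).length ≤ B
  res_le : T * (n + 1) ≤ B

variable {M : EnumMachine} {P : GraphClass} {B n T : ℕ} {G : SimpleGraph (Fin n)} {d : Data n}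

theorem Fits.le (h : Fits M P G T B) : n ≤ B := by
  rcases n with _ | n
  · exact Nat.zero_le _
  · exact (Nat.le_mul_of_pos_right _ (Nat.succ_pos _)).trans h.graph_le

/-- Run the machine on `cur`, without recording, and empty `cur`. -/
theorem ex_run_clear (h : Fits M P G T B) {S : Set (Fin n)} (collect : Bool) :
    ∃ full, (full = true ↔ P.IsSetOf G S) ∧
    Ex B (.seq (run collect) (clear .cur)) { st M G T d with cur := vertexSetCode S }
      { st M G T d with
        ctl := { (st M G T d).ctl with
          full := full
          halted := (simCfg M (graphCode (sub G S)) T).l.isNone }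
        res := (bif collect then record (emissions M (graphCode (sub G S)) T) else []) ++ d.res } := by
  obtain ⟨t, ht⟩ := h.enum S
  refine ⟨(emissions M (graphCode (sub G S)) T).any (·.all id), ?_, ?_⟩
  · rw [emissions_any_all ht, isSetOf_sub_univ]
    rw [isSetOf_sub_univ]
    exact h.halts S
  · refine .seq (.run collect h.graph_le h.budget_le (h.stk_le S) ⟨rfl, rfl, rfl, rfl, rfl, rfl⟩
      rfl rfl rfl) ((Ex.clear ?_).of_eq ?_)
    · simpa [St.get] using h.le
    · simp [St.set, st]

/-! ### Greedy extension -/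

/-- Put the vector with left part `left` (reversed), middle bit `b` and right part `right` on `cur`,
given programs that copy these parts. -/
def plug (b : Bool) (right left : Pr M) : Pr M :=
  .seq right <| .seq (pour .tmp .cur id) <| .seq (clear .tmp) <|
  .seq (.push (.inr .cur) fun _ => b) left

theorem ex_plug {b : Bool} {right left : Pr M} {s : St M} {l r : List Bool} (hr : r.length ≤ B)
    (ht : s.tmp = []) (hc : s.cur = [])
    (h₁ : Ex B right s { s with tmp := r.reverse })
    (h₂ : Ex B left { s with cur := b :: r } { s with cur := l.reverse ++ b :: r }) :
    Ex B (plug b right left) s { s with cur := l.reverse ++ b :: r } := by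
  refine .seq h₁ ?_
  refine .seq (s₁ := { s with tmp := r.reverse, cur := r }) ((Ex.pour ?_).of_eq ?_) ?_
  · simpa [St.get] using hr
  · simp [St.get, St.set, hc]
  refine .seq (s₁ := { s with cur := r }) ((Ex.clear ?_).of_eq ?_) ?_
  · simpa [St.get] using hr
  · simp [St.set, ht]
  exact .seq .push h₂

/-- Extend the set on `right` greedily to a maximal one, whose reversed vector is put on `left`. -/
noncomputable def extendP : Pr M :=
  .forEach (.inr .ones) fun _ => .pop (.inr .right) fun o =>
    .seq (plug true (pour .right .tmp id) (pour .left .cur id)) <|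
    .seq (.seq (run false) (clear .cur)) <|
    .seq (.ite (fun c => c.full) (.push (.inr .left) fun _ => true)
        (.push (.inr .left) fun _ => o.getD false))
      (.load fun c => { c with full := false, halted := false })

theorem ex_extendP (h : Fits M P G T B) (U : Set (Fin n)) :
    Ex B extendP (st M G T { d with left := [], right := vertexSetCode U })
      (st M G T { d with left := (vertexSetCode (extend P G U)).reverse, right := [] }) := by
  classical
  refine .forEach (l := List.replicate n true) rfl (by simpa using h.le) ?_
  -- Invariant: `left` holds the decided bits of the growing set in reverse, `right` the undecided
  -- bits, which are still those of `U`.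
  let I : ℕ → St M := fun i => st M G T { d with
    left := ((vertexSetCode (grow P G U i)).take i).reverse
    right := (vertexSetCode U).drop i }
  refine .of_eq (s₁ := I n) ?_ ?_
  rotate_left
  · have h₁ : (vertexSetCode (grow P G U n)).take n = vertexSetCode (grow P G U n) :=
      List.take_of_length_le (by simp)
    have h₂ : (vertexSetCode U).drop n = [] := List.drop_of_length_le (by simp)
    simp only [I, h₁, h₂, extend]
  have hI0 : st M G T { d with left := [], right := vertexSetCode U } = I 0 := by simp [I]
  rw [hI0]
  refine .of_eq (ExLoop.of_index (I := I) ?_) (by simp)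
  intro i hi
  have hi : i < n := by simpa using hi
  have hpop : (I i).get .right = ind U ⟨i, hi⟩ :: (vertexSetCode U).drop (i + 1) :=
    drop_vertexSetCode hi
  refine .pop ?_
  rw [hpop]
  set W := grow P G U i with hW
  have hWU : ∀ j : Fin n, i ≤ j → (j ∈ W ↔ j ∈ U) := fun j hj => mem_grow_of_le hj
  have hset : (I i).set .right (ind U ⟨i, hi⟩ :: (vertexSetCode U).drop (i + 1)).tail =
      st M G T { d with
        left := ((vertexSetCode W).take i).reverse
        right := (vertexSetCode U).drop (i + 1) } := rfl
  rw [hset]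
  obtain ⟨full, hfull, hrun⟩ := ex_run_clear (d := { d with
        left := ((vertexSetCode W).take i).reverse
        right := (vertexSetCode U).drop (i + 1) }) h (S := insert ⟨i, hi⟩ W) false
  refine .seq ?_ (.seq hrun ?_)
  · refine (ex_plug (l := ((vertexSetCode W).take i).reverse)
      (r := (vertexSetCode U).drop (i + 1)) ?_ rfl rfl ((Ex.pour ?_).of_eq ?_)
      ((Ex.pour ?_).of_eq ?_)).of_eq ?_
    · simp only [List.length_drop, length_vertexSetCode]
      exact (Nat.sub_le _ _).trans h.le
    · simp only [St.get, st, List.length_drop, length_vertexSetCode]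
      exact (Nat.sub_le _ _).trans h.le
    · simp [St.get, St.set, st]
    · simp only [St.get, st, List.length_reverse, List.length_take, length_vertexSetCode]
      exact (min_le_right _ _).trans h.le
    · simp [St.get, St.set, st]
    · rw [List.reverse_reverse, take_append_drop_vertexSetCode (W := insert ⟨i, hi⟩ W) hi]
      · intro j hj
        rw [Set.mem_insert_iff, or_iff_right]
        intro he
        rw [he] at hj
        exact lt_irrefl _ hj
      · simp
      · intro j hj
        rw [Set.mem_insert_iff, hWU j hj.le, or_iff_right]
        intro he
        rw [he] at hj
        exact lt_irrefl _ hj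
  · have hgrow : grow P G U (i + 1) = if P.IsSetOf G (insert ⟨i, hi⟩ W) then insert ⟨i, hi⟩ W else W :=
      grow_succ (P := P) (G := G) (U := U) ⟨i, hi⟩
    have hagree : ∀ j : Fin n, (j : ℕ) < i → (j ∈ grow P G U (i + 1) ↔ j ∈ W) := by
      intro j hj
      rw [hgrow]
      split_ifs
      · rw [Set.mem_insert_iff, or_iff_right]
        intro he
        rw [he] at hj
        exact lt_irrefl _ hj
      · rfl
    -- If the test fails, the vertex keeps its bit from `U`; `U` is not assumed to be a `P` set
    -- here.
    have hlast : ind (grow P G U (i + 1)) ⟨i, hi⟩ = (full || ind U ⟨i, hi⟩) := by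
      rw [hgrow]
      by_cases hP : P.IsSetOf G (insert ⟨i, hi⟩ W)
      · rw [if_pos hP, hfull.2 hP, Bool.true_or, ind_eq_true]
        exact Set.mem_insert _ _
      · rw [if_neg hP, Bool.eq_false_iff.2 fun hf => hP (hfull.1 hf), Bool.false_or]
        unfold ind
        rw [decide_eq_decide.2 (hWU ⟨i, hi⟩ le_rfl)]
    have hI : I (i + 1) = st M G T { d with
        left := (full || ind U ⟨i, hi⟩) :: ((vertexSetCode W).take i).reverse
        right := (vertexSetCode U).drop (i + 1) } := by
      simp only [I]
      rw [take_succ_vertexSetCode hi hagree, hlast]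
      simp
    rw [hI]
    set l := ((vertexSetCode W).take i).reverse
    refine .seq (s₁ := { st M G T { d with
        left := (full || ind U ⟨i, hi⟩) :: l
        right := (vertexSetCode U).drop (i + 1) } with
      ctl := ⟨none, M.initialState, true, full,
        (simCfg M (graphCode (sub G (insert ⟨i, hi⟩ W))) T).l.isNone, d.solved, false, false,
        d.finished⟩ }) (.ite (fun hf => Ex.push.of_eq ?_) fun hf => Ex.push.of_eq ?_)
      (Ex.load.of_eq ?_)
    · have hf : full = true := hf
      simp [St.set, St.get, st, hf]
    · have hf : full = false := hf
      simp [St.set, St.get, st, hf]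
    · simp [st]

/-! ### Reporting a solution -/

/-- Copy `out` to the empty stack `cmp`. -/
def copyOut : Pr M :=
  .seq (pour .out .tmp id) <| .seq (pour .tmp .cmp id) (clear .tmp)

theorem ex_copyOut {s : St M} (hB : s.out.length ≤ B) (ht : s.tmp = []) (hc : s.cmp = []) :
    Ex B copyOut s { s with cmp := s.out } := by
  refine .seq (s₁ := { s with tmp := s.out.reverse }) ((Ex.pour hB).of_eq ?_) ?_
  · simp [St.get, St.set, ht]
  refine .seq (s₁ := { s with tmp := s.out.reverse, cmp := s.out }) ((Ex.pour ?_).of_eq ?_) ?_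
  · simpa [St.get] using hB
  · simp [St.get, St.set, hc]
  refine (Ex.clear ?_).of_eq ?_
  · simpa [St.get] using hB
  · simp [St.set, ht]

/-- Process a symbol of the list of solutions in the search for `out`. -/
def compareStep (o : Option Bool) : Pr M :=
  match o with
  | some b => .pop (.inr .cmp) fun o' =>
      bif o' == some b then skip else .load fun c => { c with same := false }
  | none => .seq (.load fun c => { c with dup := c.dup || c.same, same := true }) copyOut

theorem exLoop_compare : ∀ (x y : List Bool) (s : St M), x.length = y.length → s.cmp = y →
    ExLoop B (compareStep : Option Bool → Pr M) (x.map some) s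
      { s with cmp := [], ctl := { s.ctl with same := s.ctl.same && decide (x = y) } }
  | [], y, s, hl, hs => by
    obtain rfl : y = [] := List.length_eq_zero_iff.1 hl.symm
    refine ExLoop.nil.of_eq ?_
    simp [← hs]
  | b :: x, [], s, hl, hs => by simp at hl
  | b :: x, c :: y, s, hl, hs => by
    refine .cons (s₁ := { s with
      cmp := y, ctl := { s.ctl with same := s.ctl.same && decide (b = c) } }) (.pop ?_) ?_
    · have h₁ : s.get .cmp = c :: y := hs
      rw [h₁]
      cases h : (some c == some b)
      · have hbc : b ≠ c := by rintro rfl; simp at h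
        simp only [List.head?_cons, h, cond_false]
        refine Ex.load.of_eq ?_
        simp [St.set, hbc]
      · have hbc : b = c := by simpa using (eq_of_beq h).symm
        simp only [List.head?_cons, h, cond_true]
        refine Ex.skip.of_eq ?_
        simp [St.set, hbc]
    · refine (exLoop_compare x y _ (by simpa using hl) rfl).of_eq ?_
      simp [Bool.and_assoc]

open Classical in
-- At each separator the verdict of one comparison is added to `dup` and `cmp` is refilled from
-- `out`. All vectors have length `n`, so a comparison consumes `cmp` exactly.
theorem exLoop_compareAll {E : Set (Fin n)} (hn : n ≤ B) : ∀ (L : List (Set (Fin n))) (s : St M),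
    s.out = vertexSetCode E → s.cmp = vertexSetCode E → s.tmp = [] → s.ctl.same = true →
    ExLoop B (compareStep : Option Bool → Pr M) (solsCode L) s
      { s with ctl := { s.ctl with dup := s.ctl.dup || decide (E ∈ L) } }
  | [], s, h₁, h₂, h₃, h₄ => ExLoop.nil.of_eq (by simp)
  | Z :: L, s, h₁, h₂, h₃, h₄ => by
    have hcode : solsCode (Z :: L) = (vertexSetCode Z).map some ++ none :: solsCode L := by
      simp [solsCode]
    have hdec : decide (vertexSetCode Z = s.cmp) = decide (E = Z) := by
      rw [h₂]
      exact decide_eq_decide.2 (vertexSetCode_injective.eq_iff.trans eq_comm)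
    rw [hcode]
    refine .append (exLoop_compare _ _ s (by simp) h₂) (.cons (.seq .load (ex_copyOut ?_ h₃ rfl)) ?_)
    · simpa [h₁] using hn
    · refine .of_eq (exLoop_compareAll (E := E) hn L _ h₁ h₁ h₃ rfl) ?_
      simp only [h₄, hdec, h₁, ← h₂, List.mem_cons, Bool.true_and, Bool.or_assoc, Bool.decide_or]

/-- Report the set whose vector is on `out` and whose reversed vector is on `left`, unless it has
been reported before. -/
def report : Pr M :=
  .seq copyOut <|
  .seq (.load fun c => { c with same := true }) <|
  .seq (.forEach (.inr .found) compareStep) <|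
  .seq (clear .cmp) <|
  .seq (.ite (fun c => c.dup) skip
    (.seq (.push (.inr .found) fun _ => none) <| .seq (pour .left .found some) .emit))
    (.load fun c => { c with dup := false, same := false })

open Classical in
/-- Add a set to a list of sets, unless it is there already. -/
noncomputable def insertSol (L : List (Set (Fin n))) (E : Set (Fin n)) : List (Set (Fin n)) :=
  if E ∈ L then L else E :: L

/-- The states `st` tie `found` and the trace to one list `sols`, newest first. A new solution is
pushed and emitted once, an old one changes neither, so the words output are distinct as long as
`sols` has no duplicates. -/
theorem ex_report (hn : n ≤ B) (hL : d.sols.length * (n + 1) ≤ B) {E : Set (Fin n)}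
    (hout : d.out = vertexSetCode E) (hleft : d.left = (vertexSetCode E).reverse) :
    Ex B report (st M G T d) (st M G T { d with sols := insertSol d.sols E }) := by
  classical
  have hout' : (st M G T d).out = vertexSetCode E := hout
  refine .seq (ex_copyOut (by simpa [hout'] using hn) rfl rfl) <| .seq .load ?_
  refine .seq (.forEach (l := solsCode d.sols) rfl (by rwa [length_solsCode])
    (exLoop_compareAll hn d.sols _ hout' hout' rfl rfl)) ?_
  refine .seq (.clear (by simpa [St.get, hout'] using hn)) ?_
  refine .seq (s₁ := { st M G T { d with sols := insertSol d.sols E } with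
    ctl := ⟨none, M.initialState, true, false, false, d.solved, decide (E ∈ d.sols), true,
      d.finished⟩ }) (.ite (fun hd => ?_) fun hd => ?_) (Ex.load.of_eq ?_)
  · have hd : E ∈ d.sols := by simpa [st, St.set] using hd
    refine Ex.skip.of_eq ?_
    simp [insertSol, hd, st, St.set]
  · have hd : E ∉ d.sols := by simpa [st, St.set] using hd
    refine .seq .push (.seq (.pour ?_) (Ex.emit.of_eq ?_))
    · simpa [St.get, St.set, st, hleft] using hn
    · simp [insertSol, hd, st, St.set, St.get, solsCode, hleft, hout]
  · simp [st]

end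

section

variable {M : EnumMachine} {P : GraphClass} {B n T : ℕ} {G : SimpleGraph (Fin n)} {d : Data n}

/-! ### Processing the solutions of an induced subgraph -/

/-- Justifies the translation by `liftStep`: positions in `S` take the next bit of `block`, and all
others are `false`. -/
theorem vertexSetCode_eq_map_elems {S : Set (Fin n)} (U : Set (Fin (elems S).length)) :
    vertexSetCode U = (elems S).map (ind (lift S U)) := by
  have ext' : ∀ {x y : Bool}, (x = true ↔ y = true) → x = y := by decide
  have h : ∀ f : Fin n → Bool, (elems S).map f =
      (List.finRange (elems S).length).map fun i => f ((elems S).get i) := fun f => by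
    conv_lhs => rw [← List.map_get_finRange (elems S), List.map_map]
    rfl
  rw [h, vertexSetCode_eq]
  refine List.map_congr_left fun i _ => ext' ?_
  rw [ind_eq_true, ind_eq_true]
  exact ((get_elems_injective S).mem_set_image).symm

/-- One position of the translation of a vector of `G[S]` to a vector of `G`. -/
def liftStep (k : Bool) : Pr M :=
  bif k then .pop (.inr .block) fun o => .push (.inr .left) fun _ => o.getD false
  else .push (.inr .left) fun _ => false

theorem exLoop_lift (S : Set (Fin n)) (g : Fin n → Bool) : ∀ (xs : List (Fin n)) (s : St M),
    s.block = (xs.filter (ind S)).map g →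
    ExLoop B (liftStep : Bool → Pr M) (xs.map (ind S)) s { s with
      block := []
      left := (xs.map fun i => ind S i && g i).reverse ++ s.left }
  | [], s, h => ExLoop.nil.of_eq (by
      have h : s.block = [] := h
      have hs : s = { s with block := [] } := by rw [← h]
      exact hs)
  | x :: xs, s, h => by
    refine .cons (s₁ := { s with
      block := (xs.filter (ind S)).map g
      left := (ind S x && g x) :: s.left }) ?_ (.of_eq (exLoop_lift S g xs _ rfl) (by simp))
    unfold liftStep
    cases hx : ind S x
    · refine Ex.push.of_eq ?_
      simp [St.set, St.get, h, hx]
    · have h' : s.get .block = g x :: (xs.filter (ind S)).map g := by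
        change s.block = _
        simp [h, hx]
      refine .pop (.of_eq .push ?_)
      rw [h']
      simp [St.set, St.get]

/-- Extend the set whose vector, as a set of vertices of `G[arg]`, is on `block`, and report it. -/
noncomputable def handle : Pr M :=
  .seq (.forEach (.inr .arg) liftStep) <| .seq (pour .left .right id) <| .seq (clear .left) <|
  .seq extendP <| .seq (pour .left .out id) <| .seq report <| .seq (clear .left) (clear .out)

theorem ex_handle (h : Fits M P G T B) {S : Set (Fin n)} (U : Set (Fin (elems S).length))
    (hL : d.sols.length * (n + 1) ≤ B) (harg : d.arg = vertexSetCode S) (hleft : d.left = [])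
    (hright : d.right = []) (hout : d.out = []) :
    Ex B handle (st M G T { d with block := vertexSetCode U })
      (st M G T { d with block := [], sols := insertSol d.sols (extend P G (lift S U)) }) := by
  have ext' : ∀ {x y : Bool}, (x = true ↔ y = true) → x = y := by decide
  have hlift : (List.finRange n).map (fun i => ind S i && ind (lift S U) i) =
      vertexSetCode (lift S U) := by
    refine List.map_congr_left fun i _ => ext' ?_
    rw [Bool.and_eq_true, ind_eq_true, ind_eq_true]
    exact (and_iff_right_of_imp fun hi => lift_subset S U hi).trans ind_eq_true.symm
  have hB : ∀ V : Set (Fin n), (vertexSetCode V).length ≤ B := fun V => by simpa using h.le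
  refine .seq (s₁ := st M G T { d with
      block := [], left := (vertexSetCode (lift S U)).reverse })
    (.forEach (l := (List.finRange n).map (ind S)) harg (by simpa using h.le)
      (.of_eq (exLoop_lift S _ _ _ (vertexSetCode_eq_map_elems U)) ?_)) ?_
  · simp [hlift, st, hleft]
  refine .seq (s₁ := st M G T { d with
      block := [], left := (vertexSetCode (lift S U)).reverse, right := vertexSetCode (lift S U) })
    ((Ex.pour ?_).of_eq ?_) ?_
  · simpa [St.get, st] using hB (lift S U)
  · simp [St.get, St.set, st, hright]
  refine .seq (.clear (by simpa [St.get, st] using hB (lift S U))) ?_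
  refine .seq (ex_extendP (d := { d with block := [] }) h (lift S U)) ?_
  set E := extend P G (lift S U)
  refine .seq (s₁ := st M G T { d with
      block := [], left := (vertexSetCode E).reverse, right := [], out := vertexSetCode E })
    ((Ex.pour ?_).of_eq ?_) ?_
  · simpa [St.get, st] using hB E
  · simp [St.get, St.set, st, hout]
  refine .seq (ex_report (E := E) (d := { d with
    block := [], left := (vertexSetCode E).reverse, right := [], out := vertexSetCode E })
    h.le hL rfl rfl) ?_
  refine .seq (.clear (by simpa [St.get, st] using hB E)) ((Ex.clear ?_).of_eq ?_)
  · simpa [St.get, St.set, st] using hB E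
  · simp [St.set, st, hleft, hright, hout]

/-- Process a symbol of the recorded words. -/
noncomputable def handleStep (o : Option Bool) : Pr M :=
  match o with
  | some b => .push (.inr .block) fun _ => b
  | none => handle

/-- Words were recorded in reverse, so pushing their symbols in turn restores the order. -/
theorem exLoop_block : ∀ (x : List Bool) (s : St M),
    ExLoop B (handleStep : Option Bool → Pr M) (x.map some) s
      { s with block := x.reverse ++ s.block }
  | [], s => .nil
  | b :: x, s => .cons .push (.of_eq (exLoop_block x _) (by simp [St.set, St.get]))

/-- The list of solutions after processing a list of sets of vertices of `G[S]`. -/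
noncomputable def handleAll (P : GraphClass) (G : SimpleGraph (Fin n)) (S : Set (Fin n))
    (L : List (Set (Fin n))) (Us : List (Set (Fin (elems S).length))) : List (Set (Fin n)) :=
  Us.foldl (fun L U => insertSol L (extend P G (lift S U))) L

theorem length_insertSol_le (L : List (Set (Fin n))) (E : Set (Fin n)) :
    (insertSol L E).length ≤ L.length + 1 := by
  unfold insertSol
  split_ifs <;> simp

theorem mem_insertSol {L : List (Set (Fin n))} {E Z : Set (Fin n)} :
    Z ∈ insertSol L E ↔ Z = E ∨ Z ∈ L := by
  unfold insertSol
  split_ifs with h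
  · exact ⟨.inr, fun h' => h'.elim (fun e => e ▸ h) id⟩
  · exact List.mem_cons

theorem exLoop_handle (h : Fits M P G T B) {S : Set (Fin n)} :
    ∀ (Us : List (Set (Fin (elems S).length))) (d : Data n),
    (d.sols.length + Us.length) * (n + 1) ≤ B → d.arg = vertexSetCode S → d.left = [] →
    d.right = [] → d.out = [] → d.block = [] →
    ExLoop B (handleStep : Option Bool → Pr M)
      (Us.flatMap fun U => (vertexSetCode U).reverse.map some ++ [none])
      (st M G T d) (st M G T { d with sols := handleAll P G S d.sols Us })
  | [], d, hB, harg, hleft, hright, hout, hblock => .nil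
  | U :: Us, d, hB, harg, hleft, hright, hout, hblock => by
    have hB' : d.sols.length * (n + 1) ≤ B :=
      (Nat.mul_le_mul_right _ (Nat.le_add_right _ _)).trans hB
    rw [List.flatMap_cons]
    refine .append (.append (.of_eq (exLoop_block _ _) ?_)
      (.cons (ex_handle h U hB' harg hleft hright hout) .nil))
      (.of_eq (exLoop_handle h Us _ ?_ harg hleft hright hout rfl) ?_)
    · simp [st, hblock]
    · refine (Nat.mul_le_mul_right _ ?_).trans hB
      have := length_insertSol_le d.sols (extend P G (lift S U))
      simp only [List.length_cons]
      omega
    · simp [handleAll, hblock]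

/-- Run the machine on the graph induced by `cur`, and report the extensions of all solutions that it
finds. The flag `solved` tells whether the machine halted. -/
noncomputable def process : Pr M :=
  .seq (pour .cur .tmp id) <| .seq (pour .tmp .arg id) <| .seq (clear .tmp) <|
  .seq (.seq (run true) (clear .cur)) <|
  .seq (.load fun c => { c with solved := c.halted, halted := false, full := false }) <|
  .seq (.forEach (.inr .res) handleStep) <| .seq (clear .res) (clear .arg)

/-- A list of different solutions. -/
structure IsSols (P : GraphClass) (G : SimpleGraph (Fin n)) (L : List (Set (Fin n))) : Prop where
  nodup : L.Nodup
  isMax : ∀ Z ∈ L, P.IsMaximalSetOf G Z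

theorem IsSols.insertSol {L : List (Set (Fin n))} {E : Set (Fin n)} (h : IsSols P G L)
    (hE : P.IsMaximalSetOf G E) : IsSols P G (insertSol L E) := by
  refine ⟨?_, fun Z hZ => (mem_insertSol.1 hZ).elim (fun e => e ▸ hE) (h.isMax Z)⟩
  unfold StackProg.insertSol
  split_ifs with hL
  · exact h.nodup
  · exact List.nodup_cons.2 ⟨hL, h.nodup⟩

/-- Each listed set is replaced by a greedy extension, which is maximal in `G` and contains it; the
first property preserves `IsSols`, the second gives the covering. -/
theorem handleAll_spec (hP : P.Hereditary) {S : Set (Fin n)} :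
    ∀ (Us : List (Set (Fin (elems S).length))) (L : List (Set (Fin n))),
    (∀ U ∈ Us, P.IsMaximalSetOf (sub G S) U) → IsSols P G L →
    IsSols P G (handleAll P G S L Us) ∧ L ⊆ handleAll P G S L Us ∧
    (handleAll P G S L Us).length ≤ L.length + Us.length ∧
    ∀ U ∈ Us, ∃ Z ∈ handleAll P G S L Us, lift S U ⊆ Z
  | [], L, _, hL => ⟨hL, List.Subset.refl _, le_rfl, by simp⟩
  | U :: Us, L, hUs, hL => by
    have hE := isMaximalSetOf_extend hP (isSetOf_sub.1 (hUs U (by simp)).1)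
    obtain ⟨h₁, h₂, h₃, h₄⟩ := handleAll_spec hP Us (insertSol L (extend P G (lift S U)))
      (fun V hV => hUs V (by simp [hV])) (hL.insertSol hE)
    have hlen := length_insertSol_le L (extend P G (lift S U))
    refine ⟨h₁, fun Z hZ => h₂ (mem_insertSol.2 (.inr hZ)), ?_, ?_⟩
    · simp only [List.length_cons]
      exact h₃.trans (by omega)
    · intro V hV
      rcases List.mem_cons.1 hV with rfl | hV
      · exact ⟨_, h₂ (mem_insertSol.2 (.inl rfl)), subset_extend _⟩
      · exact h₄ V hV

/-- The data at the beginning of a call of `process`. -/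
def loopData (a b : List Bool) (L : List (Set (Fin n))) (solved finished : Bool) : Data n where
  outerLeft := a
  outerRight := b
  sols := L
  solved := solved
  finished := finished

/-- At most one word is emitted per step, so at most `T` solutions are added. A halted run has
emitted all maximal `P` sets of `G[S]`, and their extensions cover `S`; an interrupted run only adds
solutions. -/
theorem ex_process (hP : P.Hereditary) (h : Fits M P G T B) (S : Set (Fin n)) {a b : List Bool}
    {L : List (Set (Fin n))} (hL : IsSols P G L) (hB : (L.length + T) * (n + 1) ≤ B) (f : Bool) :
    ∃ L' solved, Ex B process { st M G T (loopData a b L false f) with cur := vertexSetCode S }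
      (st M G T (loopData a b L' solved f)) ∧
    (solved = true ↔ (simCfg M (graphCode (sub G S)) T).l = none) ∧
    IsSols P G L' ∧ L ⊆ L' ∧ L'.length ≤ L.length + T ∧ (solved = true → Covers P G L' S) := by
  obtain ⟨t, ht⟩ := h.enum S
  obtain ⟨Us, hUs, hmax⟩ := exists_map_eq_emissions ht T
  have hlen : Us.length ≤ T := by
    have := length_emissions_le (M := M) (w := graphCode (sub G S)) T
    rwa [hUs, List.length_map] at this
  have hres : record (emissions M (graphCode (sub G S)) T) =
      Us.reverse.flatMap fun U => (vertexSetCode U).reverse.map some ++ [none] := by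
    rw [hUs, record, ← List.map_reverse, List.flatMap_map]
  have hres_le : (record (emissions M (graphCode (sub G S)) T)).length ≤ B := by
    refine le_trans ?_ h.res_le
    rw [hres, List.length_flatMap]
    refine (List.sum_le_card_nsmul _ ((elems S).length + 1) ?_).trans ?_
    · simp
    · simpa using Nat.mul_le_mul hlen (Nat.succ_le_succ (length_elems_le S))
  obtain ⟨h₁, h₂, h₃, h₄⟩ := handleAll_spec hP Us.reverse L
    (fun U hU => hmax U (List.mem_reverse.1 hU)) hL
  have hn : (vertexSetCode S).length ≤ B := by simpa using h.le
  refine ⟨handleAll P G S L Us.reverse, (simCfg M (graphCode (sub G S)) T).l.isNone, ?_,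
    Option.isNone_iff_eq_none, h₁, h₂, ?_, ?_⟩
  · set d := loopData a b L false f
    refine .seq (.pour hn) ?_
    refine .seq (s₁ := { st M G T { d with arg := vertexSetCode S } with
      cur := vertexSetCode S, tmp := (vertexSetCode S).reverse }) ((Ex.pour ?_).of_eq ?_) ?_
    · simpa [St.get, St.set, st] using hn
    · simp [St.get, St.set, st, d, loopData]
    refine .seq (s₁ := { st M G T { d with arg := vertexSetCode S } with cur := vertexSetCode S })
      ((Ex.clear ?_).of_eq ?_) ?_
    · simpa [St.get] using hn
    · simp [St.set, st]
    obtain ⟨full, -, hrun⟩ := ex_run_clear (d := { d with arg := vertexSetCode S }) h (S := S) true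
    refine .seq hrun ?_
    refine .seq (s₁ := st M G T { d with
      arg := vertexSetCode S
      solved := (simCfg M (graphCode (sub G S)) T).l.isNone
      res := record (emissions M (graphCode (sub G S)) T) }) (Ex.load.of_eq ?_) ?_
    · simp [st, d, loopData]
    refine .seq (.forEach hres (by rwa [← hres]) (exLoop_handle h Us.reverse _ ?_ rfl rfl rfl rfl rfl))
      ?_
    · exact (Nat.mul_le_mul_right _ (Nat.add_le_add_left (by simpa using hlen) _)).trans hB
    refine .seq (.clear hres_le) ((Ex.clear ?_).of_eq ?_)
    · simpa [St.get, St.set, st] using hn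
    · simp [St.set, st, d, loopData]
  · exact h₃.trans (Nat.add_le_add_left (by simpa using hlen) _)
  · intro hs
    refine covers_of_isMaximalSetOf_sub fun U hU => ?_
    have hmem := (mem_emissions_iff ht (Option.isNone_iff_eq_none.1 hs) _).2 ⟨U, hU, rfl⟩
    rw [hUs, List.mem_map] at hmem
    obtain ⟨V, hV, hVU⟩ := hmem
    rw [vertexSetCode_injective hVU] at hV
    exact h₄ U (List.mem_reverse.2 hV)

/-! ### The main loop -/

/-- Process the current set without its next vertex, and keep that vertex if this was successful. -/
noncomputable def shrinkStep : Pr M :=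
  .pop (.inr .outerRight) fun _ =>
    .seq (plug false (pour .outerRight .tmp id) (pour .outerLeft .cur id)) <| .seq process <|
    .seq (.ite (fun c => c.solved) (.push (.inr .outerLeft) fun _ => true)
      (.push (.inr .outerLeft) fun _ => false)) (.load fun c => { c with solved := false })

/-- One iteration of the main loop. -/
noncomputable def stage : Pr M :=
  .seq (pour .ones .cur id) <| .seq process <|
  .ite (fun c => c.solved) (.load fun c => { c with solved := false, finished := true }) <|
  .seq (pour .ones .outerRight id) <|
  .seq (.forEach (.inr .ones) fun _ => shrinkStep) <| .seq (clear .outerLeft) (.push (.inr .budget) fun _ => ())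

theorem vertexSetCode_univ : vertexSetCode (Set.univ : Set (Fin n)) = List.replicate n true := by
  refine List.eq_replicate_iff.2 ⟨by simp, ?_⟩
  simp [vertexSetCode_eq, ind]

/-- Either the run on `G` halts and everything is covered, or one pass of deletions produces a graph
`G[K]` that exceeds the budget and has few solutions. The `n + 1` calls of `process` account for the
growth of the list. -/
theorem ex_stage (hP : P.Hereditary) (h : Fits M P G T B) {L : List (Set (Fin n))}
    (hL : IsSols P G L) (hB : (L.length + (n + 1) * T) * (n + 1) ≤ B) :
    ∃ L', IsSols P G L' ∧ L'.length ≤ L.length + (n + 1) * T ∧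
    ((Ex B stage (st M G T (loopData [] [] L false false))
        (st M G T (loopData [] [] L' false true)) ∧ Covers P G L' Set.univ) ∨
      (Ex B stage (st M G T (loopData [] [] L false false))
        (st M G (T + 1) (loopData [] [] L' false false)) ∧
        ∃ K, (simCfg M (graphCode (sub G K)) T).l ≠ none ∧
          P.numSolutions (sub G K) ≤ L'.length)) := by
  have hB' : ∀ (L' : List (Set (Fin n))) (i : ℕ), i ≤ n → L'.length ≤ L.length + i * T →
      (L'.length + T) * (n + 1) ≤ B := fun L' i hi hL' => by
    refine (Nat.mul_le_mul_right _ ?_).trans hB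
    have := Nat.mul_le_mul_right T (Nat.add_le_add_right hi 1)
    rw [Nat.add_mul i, one_mul] at this
    omega
  obtain ⟨L₁, solved, hex, hsolved, hL₁, -, hlen₁, hcov₁⟩ := ex_process (a := []) (b := []) hP h
    Set.univ hL (hB' L 0 (Nat.zero_le _) (by omega)) false
  have hones : Ex B (pour .ones .cur id : Pr M) (st M G T (loopData [] [] L false false))
      { st M G T (loopData [] [] L false false) with cur := vertexSetCode (Set.univ : Set (Fin n)) } := by
    refine (Ex.pour ?_).of_eq ?_
    · simpa [St.get, st] using h.le
    · simp [St.get, St.set, st, vertexSetCode_univ]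
  cases solved with
  | true =>
    refine ⟨L₁, hL₁, hlen₁.trans ?_, .inl ⟨?_, hcov₁ rfl⟩⟩
    · rw [Nat.succ_mul]
      omega
    · refine .seq hones (.seq hex (.ite (fun _ => Ex.load.of_eq ?_) fun hf => ?_))
      · simp [st, loopData]
      · simp [st, loopData] at hf
  | false =>
    -- The pass keeps coverings of `K \ {v}` for the vertices already retained, and not halting of
    -- `M`, whose running time need not be monotone under taking induced subgraphs.
    let I : ℕ → St M → Prop := fun i s => ∃ K L', s = st M G T (loopData
        ((vertexSetCode K).take i).reverse ((vertexSetCode (Set.univ : Set (Fin n))).drop i) L' false false) ∧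
      (∀ v : Fin n, i ≤ v → v ∈ K) ∧ (simCfg M (graphCode (sub G K)) T).l ≠ none ∧
      IsSols P G L' ∧ (∀ v ∈ K, (v : ℕ) < i → Covers P G L' (K \ {v})) ∧
      L'.length ≤ L.length + (i + 1) * T
    have hstep : ∀ i (hi : i < (List.replicate n true).length) s, I i s →
        ∃ s', Ex B (shrinkStep : Pr M) s s' ∧ I (i + 1) s' := by
      rintro i hi s ⟨K, L', rfl, hKi, hK, hL', hcov, hlen'⟩
      have hi : i < n := by simpa using hi
      set W : Set (Fin n) := K \ {⟨i, hi⟩} with hW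
      set a := ((vertexSetCode K).take i).reverse with ha
      set b := (vertexSetCode (Set.univ : Set (Fin n))).drop (i + 1) with hb
      obtain ⟨L'', solved, hex', hsolved', hL'', hsub, hlen'', hcov'⟩ :=
        ex_process (a := a) (b := b) hP h W hL'
          (hB' L' (i + 1) hi hlen') false
      have hcat : a.reverse ++ false :: b = vertexSetCode W := by
        rw [ha, List.reverse_reverse]
        refine take_append_drop_vertexSetCode hi (fun j hj => ?_) ?_ fun j hj => ?_
        · exact ⟨fun hj' => hj'.1, fun hj' => ⟨hj', fun he => by
            rw [Set.mem_singleton_iff.1 he] at hj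
            exact lt_irrefl _ hj⟩⟩
        · simp [hW]
        · refine iff_of_true ⟨hKi j hj.le, fun he => ?_⟩ trivial
          rw [Set.mem_singleton_iff.1 he] at hj
          exact lt_irrefl _ hj
      have hpop : (st M G T (loopData a ((vertexSetCode (Set.univ : Set (Fin n))).drop i) L' false false)).get
          .outerRight = ind (Set.univ : Set (Fin n)) ⟨i, hi⟩ :: b := drop_vertexSetCode hi
      refine ⟨st M G T (loopData (solved :: a) b L'' false false), .pop ?_, ?_⟩
      · rw [hpop]
        refine .seq (s₁ := { st M G T (loopData a b L' false false) with cur := vertexSetCode W })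
          ?_ (.seq hex' ?_)
        · refine (ex_plug (l := a) (r := b) ?_ rfl rfl ((Ex.pour ?_).of_eq ?_)
            ((Ex.pour ?_).of_eq ?_)).of_eq ?_
          · simp only [hb, List.length_drop, length_vertexSetCode]
            exact (Nat.sub_le _ _).trans h.le
          · simp only [St.get, St.set, List.tail_cons, hb, List.length_drop, length_vertexSetCode]
            exact (Nat.sub_le _ _).trans h.le
          · simp [St.get, St.set, st]
          · simp only [St.get, St.set, st, loopData, ha, List.length_reverse, List.length_take,
              length_vertexSetCode]
            exact (min_le_right _ _).trans h.le
          · simp [St.get, St.set, st, loopData]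
          · rw [hcat]
            simp [St.set, st, loopData]
        · refine .seq (s₁ := st M G T (loopData (solved :: a) b L'' solved false))
            (.ite (fun hf => Ex.push.of_eq ?_) fun hf => Ex.push.of_eq ?_) (Ex.load.of_eq ?_)
          · have hf : solved = true := hf
            simp [St.set, St.get, st, loopData, hf]
          · have hf : solved = false := hf
            simp [St.set, St.get, st, loopData, hf]
          · simp [st, loopData]
      · have hlen3 : L''.length ≤ L.length + (i + 1 + 1) * T := by
          rw [Nat.succ_mul]
          omega
        have hcovL : ∀ v ∈ K, (v : ℕ) < i → Covers P G L'' (K \ {v}) := fun v hv hvi =>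
          (hcov v hv hvi).mono hsub le_rfl
        cases hs : solved with
        | true =>
          refine ⟨K, L'', ?_, fun v hv => hKi v (by omega), hK, hL'', fun v hv hvi => ?_, hlen3⟩
          · rw [take_succ_vertexSetCode hi fun _ _ => Iff.rfl,
              ind_eq_true.2 (hKi ⟨i, hi⟩ le_rfl)]
            simp [ha, hb]
          · rcases Nat.lt_succ_iff_lt_or_eq.1 hvi with hvi | hvi
            · exact hcovL v hv hvi
            · obtain rfl : v = ⟨i, hi⟩ := Fin.ext hvi
              exact hcov' hs
        | false =>
          refine ⟨W, L'', ?_, fun v hv => ⟨hKi v (by omega), fun he => ?_⟩, fun hh => ?_, hL'',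
            fun v hv hvi => ?_, hlen3⟩
          · rw [take_succ_vertexSetCode (U := K) hi, ind_eq_false.2 fun hh => hh.2 rfl]
            · simp [ha, hb]
            · exact fun j hj => ⟨fun hj' => hj'.1, fun hj' => ⟨hj', fun he => by
                rw [Set.mem_singleton_iff.1 he] at hj
                exact lt_irrefl _ hj⟩⟩
          · rw [Set.mem_singleton_iff.1 he] at hv
            simp at hv
          · have := hsolved'.2 hh
            rw [hs] at this
            exact absurd this (by decide)
          · rcases Nat.lt_succ_iff_lt_or_eq.1 hvi with hvi | hvi
            -- Coverings survive later deletions from `K`; this is why each vertex has to be tried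
            -- only once.
            · exact (hcovL v hv.1 hvi).mono (List.Subset.refl _)
                (Set.sdiff_subset_sdiff_left Set.sdiff_subset)
            · exact absurd (Fin.ext hvi) hv.2
    obtain ⟨s', hloop, K, L', hs', -, hK, hL', hcov, hlen'⟩ := ExLoop.exists_of_index (I := I)
      (B := B) (b := fun _ => (shrinkStep : Pr M))
      (l := List.replicate n true) (s := st M G T (loopData [] (vertexSetCode Set.univ) L₁ false false))
      ⟨Set.univ, L₁, rfl, by simp,
        fun hh => by simpa using hsolved.2 hh, hL₁, by simp, by simpa using hlen₁⟩ hstep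
    simp only [List.length_replicate] at hs' hcov hlen'
    refine ⟨L', hL', hlen', .inr ⟨?_, K, hK, ?_⟩⟩
    · refine .seq hones (.seq hex (.ite (fun hf => ?_) fun _ => ?_))
      · simp [st, loopData] at hf
      refine .seq (s₁ := st M G T (loopData [] (vertexSetCode (Set.univ : Set (Fin n))) L₁ false false))
        ((Ex.pour ?_).of_eq ?_) ?_
      · simpa [St.get, st] using h.le
      · simp [St.get, St.set, st, vertexSetCode_univ, loopData]
      refine .seq (.forEach rfl (by simpa [st, St.get] using h.le) hloop) ?_
      rw [hs']
      refine .seq (.clear ?_) (Ex.push.of_eq ?_)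
      · simpa [St.get, st, loopData] using h.le
      · simp [St.get, St.set, st, loopData, List.replicate_succ,
          List.drop_of_length_le (length_vertexSetCode _).le]
    -- `G[K]` is outside the class because `M` would otherwise have halted on it.
    · exact numSolutions_sub_le hP (fun Z hZ => (hL'.isMax Z hZ).1) (fun hPK => hK (h.halts K hPK))
        fun v hv => hcov v hv v.2

end

section

variable {M : EnumMachine} {P : GraphClass} {B n T : ℕ} {G : SimpleGraph (Fin n)} {d : Data n}

/-! ### Initialization -/

/-- Multiply the length of `budget` by the number of vertices plus one. -/
def multiply : Pr M :=
  .seq (.forEach (.inr .budget) fun _ =>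
    .seq (pour .ones .tmp id) (.push (.inr .tmp) fun _ => true)) <|
  .seq (clear .budget) <| .seq (pour .tmp .budget fun _ => ()) (clear .tmp)

theorem ex_multiply (hn : n ≤ B) (h : T * (n + 1) ≤ B) :
    Ex B multiply (st M G T d) (st M G (T * (n + 1)) d) := by
  have hT : T ≤ B := (Nat.le_mul_of_pos_right T n.succ_pos).trans h
  have hloop := ExLoop.of_index (B := B) (M := M) (l := List.replicate T ())
    (b := fun _ => .seq (pour .ones .tmp id) (.push (.inr .tmp) fun _ => true))
    (I := fun i => { st M G T d with tmp := List.replicate (i * (n + 1)) true }) fun i _ => by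
      refine .seq (.pour (by simpa [St.get, st] using hn)) (Ex.push.of_eq ?_)
      have e : (i + 1) * (n + 1) = n + i * (n + 1) + 1 := by ring
      simp [St.get, St.set, st, e, List.replicate_succ]
  refine .seq (s₁ := { st M G T d with tmp := List.replicate (T * (n + 1)) true })
    (.forEach (l := List.replicate T ()) rfl (by simpa using hT) ?_) ?_
  · simpa [st] using hloop
  refine .seq (.clear (by simpa [St.get, st] using hT)) ?_
  refine .seq (.pour (by simpa [St.get, St.set, st] using h)) (.of_eq (.clear ?_) ?_)
  · simpa [St.get, St.set, st] using h
  · simp [St.get, St.set, st]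

/-- Iterate a program. -/
def repeatProg (p : Pr M) : ℕ → Pr M
  | 0 => skip
  | d + 1 => .seq p (repeatProg p d)

theorem ex_repeat_multiply (hn : n ≤ B) : ∀ (k T : ℕ), T * (n + 1) ^ k ≤ B →
    Ex B (repeatProg multiply k) (st M G T d) (st M G (T * (n + 1) ^ k) d)
  | 0, T, _ => Ex.skip.of_eq (by simp)
  | k + 1, T, h => by
    have e : T * (n + 1) ^ (k + 1) = T * (n + 1) * (n + 1) ^ k := by
      rw [pow_succ']
      ring
    rw [e] at h ⊢
    have hT : T * (n + 1) ≤ B := (Nat.le_mul_of_pos_right _ (pow_pos n.succ_pos k)).trans h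
    exact .seq (ex_multiply hn hT) (ex_repeat_multiply hn k _ h)

theorem ex_repeat_push : ∀ C T : ℕ,
    Ex B (repeatProg (.push (.inr .budget) fun _ => ()) C) (st M G T d) (st M G (C + T) d)
  | 0, T => Ex.skip.of_eq (by simp)
  | C + 1, T => by
    refine .seq (s₁ := st M G (T + 1) d) (Ex.push.of_eq ?_)
      ((ex_repeat_push C (T + 1)).of_eq (by rw [Nat.add_right_comm, Nat.add_assoc]))
    simp [St.get, St.set, st, List.replicate_succ]

/-- Count a row of the adjacency matrix at its end. -/
def countStep (o : Option Bool) : Pr M :=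
  match o with
  | none => .push (.inr .ones) fun _ => true
  | some _ => skip

/-- Count the rows of the adjacency matrix. -/
def countRows : Pr M := .forEach (.inr .inp) countStep

/-- The number of vertices is not given separately; it is the number of separators in the input. -/
theorem ex_countRows (hn : n * (n + 1) ≤ B) :
    Ex B countRows { st M G T d with ones := [] } (st M G T d) := by
  have key : ∀ (w : List (Option Bool)) (s : St M), ExLoop B countStep w s
      { s with ones := List.replicate (w.count none) true ++ s.ones } := by
    intro w
    induction w with
    | nil => exact fun s => .nil
    | cons o w ih =>
      intro s
      cases o with
      | none =>
        refine .cons .push ((ih _).of_eq ?_)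
        simp [St.get, St.set, List.replicate_succ']
      | some b =>
        refine .cons .skip ((ih _).of_eq ?_)
        simp
  have hcount : (graphCode G).count none = n := by
    have h : ∀ f : Fin n → Bool, List.count none ((List.finRange n).map fun j => some (f j)) = 0 :=
      fun f => List.count_eq_zero.2 (by simp)
    simp [graphCode, List.count_flatMap, Function.comp_def, h]
  refine .forEach (l := graphCode G) rfl (by rwa [length_graphCode])
    ((key (graphCode G) { st M G T d with ones := [] }).of_eq ?_)
  simp [hcount, st]

/-- Initialization: set the budget to `C * (n + 1) ^ k`. -/
def prepare (C k : ℕ) : Pr M :=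
  .seq countRows <| .seq (repeatProg (.push (.inr .budget) fun _ => ()) C) (repeatProg multiply k)

theorem ex_prepare {C k : ℕ} (hn : n * (n + 1) ≤ B) (h : C * (n + 1) ^ k ≤ B) :
    Ex B (prepare C k) { st M G 0 d with ones := [] } (st M G (C * (n + 1) ^ k) d) := by
  have hnB : n ≤ B := (Nat.le_mul_of_pos_right n n.succ_pos).trans hn
  exact .seq (ex_countRows hn) (.seq (ex_repeat_push C 0) (ex_repeat_multiply hnB k C h))

/-! ### The machine of a pair of programs -/

section

instance (M : EnumMachine) (k : M.K ⊕ Var) : Finite (SimAlph M k) := by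
  rcases k with k | v
  · exact M.finite_alphabet k
  · exact inferInstanceAs (Finite v.alph)

noncomputable instance (M : EnumMachine) (k : M.K ⊕ Var) : Fintype (SimAlph M k) := Fintype.ofFinite _

/-- The code of the machine that runs `p` and then repeats `q` until `f` holds. -/
def loopCode (p q : Pr M) (f : Ctl M → Bool) : Lab p ⊕ Lab q ⊕ Unit →
    TM2.Stmt (Alph (SimAlph M)) (Lab p ⊕ Lab q ⊕ Unit) (Ctl M × Reg (SimAlph M))
  | .inl a => code p .inl (.inr (.inr ())) a
  | .inr (.inl a) => code q (fun a => .inr (.inl a)) (.inr (.inr ())) a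
  | .inr (.inr ()) => .branch (fun v => f v.1) .halt (.goto fun _ => .inr (.inl (entry q)))

/-- The machine that runs `p` and then repeats `q` until `f` holds. -/
noncomputable def loopMachine (p q : Pr M) (f : Ctl M → Bool) : EnumMachine :=
  have := M.kFin
  have := finite_lab p
  have := finite_lab q
  { K := (M.K ⊕ Var) ⊕ Bool
    k₀ := .inl (.inr .inp)
    k₁ := .inl (.inr .out)
    Γ := Alph (SimAlph M)
    Λ := Lab p ⊕ Lab q ⊕ Unit
    main := .inl (entry p)
    ΛFin := Fintype.ofFinite _
    σ := Ctl M × Reg (SimAlph M)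
    initialState := (⟨none, M.initialState, true, false, false, false, false, false, false⟩, none)
    σFin := Fintype.ofFinite _
    Γk₀Fin := inferInstanceAs (Fintype (Option Bool))
    m := loopCode p q f
    finite_alphabet := fun k => by
      rcases k with k | k
      · exact inferInstanceAs (Finite (SimAlph M k))
      · exact inferInstanceAs (Finite (Option (Reg (SimAlph M))))
    inputAlphabet := Equiv.refl (Option Bool)
    outputAlphabet := Equiv.refl Bool
    emit := fun l => match l with
      | .inl a => isEmit p a
      | .inr (.inl a) => isEmit q a
      | .inr (.inr ()) => false }

/-- Transfers the runs of compiled code to the total semantics, in which the emissions of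
consecutive runs concatenate. -/
theorem simCfg_of_steps {N : EnumMachine} {w : List (Option Bool)} {t : ℕ}
    {c c' : TM2.Cfg N.Γ N.Λ N.σ} {o : List (List Bool)}
    (h : Steps N.m N.emit (fun S => (S N.k₁).map N.outputAlphabet) t c o c') :
    ∀ u, simCfg N w u = c →
      simCfg N w (u + t) = c' ∧ emissions N w (u + t) = emissions N w u ++ o := by
  induction h with
  | refl c => exact fun u hu => ⟨hu, by simp⟩
  | @head t c o c₁ c' h _ ih =>
    intro u hu
    have hstep : simStep N c = c₁ := by
      rw [simStep, h, Option.getD_some]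
    obtain ⟨h₁, h₂⟩ := ih (u + 1) (by rw [simCfg_succ, hu, hstep])
    rw [Nat.add_assoc, Nat.add_comm 1 t] at h₁ h₂
    refine ⟨h₁, ?_⟩
    rw [h₂, emissions_succ, hu, List.append_assoc]
    congr 2
    obtain ⟨_ | l, v, S⟩ := c
    · rfl
    · simp only [EnumMachine.emitted, emission]
      split_ifs <;> rfl

variable {p q : Pr M} {f : Ctl M → Bool} {w : List (Option Bool)}

/-- The machine is before a repetition after `t` steps, and the state is then `s`. -/
def Reach (p q : Pr M) (f : Ctl M → Bool) (w : List (Option Bool)) (t : ℕ) (s : St M) : Prop :=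
  ∃ r, simCfg (loopMachine p q f) w t =
      ⟨some (.inr (.inr ())), (s.ctl, r), hiddenStk s.toState.stk [] []⟩ ∧
    emissions (loopMachine p q f) w t = s.trace

theorem reach_of_init {s s' : St M} (hs : s.ctl = ⟨none, M.initialState, true, false, false, false,
    false, false, false⟩) (hm : ∀ k, s.mst k = []) (hw : s.inp = w)
    (hv : ∀ v, v ≠ .inp → s.get v = []) (ht : s.trace = []) (h : Ex B p s s') :
    ∃ t ≤ cost B p, Reach p q f w t s' := by
  obtain ⟨r, t, o, htB, ho, hsteps⟩ := steps_of_exec (m := (loopMachine p q f).m)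
    (em := (loopMachine p q f).emit) (rd := outWord) (e := Sum.inl) (nx := .inr (.inr ())) p
    (fun _ => rfl) (fun _ => rfl) h none []
  have hrd : (readVisible outWord : (∀ k, List (Alph (SimAlph M) k)) → List Bool) =
      fun S => (S (loopMachine p q f).k₁).map (loopMachine p q f).outputAlphabet :=
    funext fun S => (List.map_id _).symm
  rw [hrd] at hsteps
  have hinit : simCfg (loopMachine p q f) w 0 =
      ⟨some (.inl (entry p)), (s.ctl, none), hiddenStk s.toState.stk [] []⟩ := by
    change initList (loopMachine p q f).toFinTM2 _ = _
    have hstk : TM2.Cfg.stk (initList (loopMachine p q f).toFinTM2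
        (w.map (loopMachine p q f).inputAlphabet.symm)) = hiddenStk s.toState.stk [] [] := by
      rw [initList_stk]
      funext k
      rcases k with (k | v) | (_ | _)
      · exact (update_of_ne (by simp [loopMachine]) _ _).trans (hm k).symm
      · by_cases hv' : v = .inp
        · subst hv'
          refine (update_self (β := fun k => List ((loopMachine p q f).Γ k)) _ _ _).trans ?_
          exact (List.map_id w).trans hw.symm
        · exact (update_of_ne (by simpa [loopMachine] using hv') _ _).trans (hv v hv').symm
      · exact update_of_ne (by simp [loopMachine]) _ _
      · exact update_of_ne (by simp [loopMachine]) _ _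
    rw [← hstk]
    change _ = TM2.Cfg.mk _ (s.ctl, none) _
    rw [hs]
    rfl
  obtain ⟨h₁, h₂⟩ := simCfg_of_steps (N := loopMachine p q f) (w := w) hsteps 0 hinit
  rw [Nat.zero_add] at h₁ h₂
  refine ⟨t, htB, r, h₁, h₂.trans ?_⟩
  change [] ++ o = s'.trace
  have : s'.trace = s.trace ++ o := ho
  rw [this, ht]

theorem stepAux_loopCode (v : Ctl M × Reg (SimAlph M)) (S : ∀ k, List (Alph (SimAlph M) k)) :
    TM2.stepAux (loopCode p q f (.inr (.inr ()))) v S =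
      bif f v.1 then ⟨none, v, S⟩ else ⟨some (.inr (.inl (entry q))), v, S⟩ := rfl

theorem Reach.step {s s' : St M} {t : ℕ} (hr : Reach p q f w t s) (hf : f s.ctl = false)
    (h : Ex B q s s') : ∃ t' ≤ t + (cost B q + 1), Reach p q f w t' s' := by
  obtain ⟨r, hc, he⟩ := hr
  obtain ⟨r', u, o, htB, ho, hsteps⟩ := steps_of_exec (m := (loopMachine p q f).m)
    (em := (loopMachine p q f).emit) (rd := outWord) (e := fun a => Sum.inr (Sum.inl a))
    (nx := .inr (.inr ())) q (fun _ => rfl) (fun _ => rfl) h r []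
  have hrd : (readVisible outWord : (∀ k, List (Alph (SimAlph M) k)) → List Bool) =
      fun S => (S (loopMachine p q f).k₁).map (loopMachine p q f).outputAlphabet :=
    funext fun S => (List.map_id _).symm
  rw [hrd] at hsteps
  have hsteps' := Steps.silent (m := (loopMachine p q f).m) (em := (loopMachine p q f).emit)
    (l := .inr (.inr ())) (v := (s.ctl, r)) (S := hiddenStk s.toState.stk [] []) rfl (by
      have e : TM2.stepAux ((loopMachine p q f).m (.inr (.inr ()))) (s.ctl, r)
        (hiddenStk s.toState.stk [] []) =
          ⟨some (.inr (.inl (entry q))), (s.ctl, r), hiddenStk s.toState.stk [] []⟩ := by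
        refine (stepAux_loopCode _ _).trans ?_
        simp only [hf, cond_false]
        rfl
      rw [e]
      exact hsteps)
  obtain ⟨h₁, h₂⟩ := simCfg_of_steps hsteps' t hc
  refine ⟨t + (u + 1), by omega, r', h₁, h₂.trans ?_⟩
  rw [he]
  exact ho.symm

theorem Reach.halted {s : St M} {t : ℕ} (hr : Reach p q f w t s) (hf : f s.ctl = true) :
    (simCfg (loopMachine p q f) w (t + 1)).l = none ∧
      emissions (loopMachine p q f) w (t + 1) = s.trace := by
  obtain ⟨r, hc, he⟩ := hr
  rw [simCfg_succ, emissions_succ, hc, he]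
  refine ⟨?_, List.append_nil _⟩
  change TM2.Cfg.l (TM2.stepAux (loopCode p q f (.inr (.inr ()))) _ _) = none
  rw [stepAux_loopCode]
  simp only [hf, cond_true]

end

end

section

/-! ### Polynomial bounds -/

/-- Being given by a polynomial with natural coefficients. -/
def IsPoly (f : ℕ → ℕ → ℕ) : Prop :=
  ∃ q : MvPolynomial (Fin 2) ℕ, ∀ n s, MvPolynomial.eval ![n, s] q = f n s

namespace IsPoly

variable {f g : ℕ → ℕ → ℕ}

theorem const (c : ℕ) : IsPoly fun _ _ => c := ⟨.C c, by simp⟩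

theorem fst : IsPoly fun n _ => n := ⟨.X 0, by simp⟩

theorem add (hf : IsPoly f) (hg : IsPoly g) : IsPoly fun n s => f n s + g n s := by
  obtain ⟨p, hp⟩ := hf
  obtain ⟨q, hq⟩ := hg
  exact ⟨p + q, by simp [hp, hq]⟩

theorem mul (hf : IsPoly f) (hg : IsPoly g) : IsPoly fun n s => f n s * g n s := by
  obtain ⟨p, hp⟩ := hf
  obtain ⟨q, hq⟩ := hg
  exact ⟨p * q, by simp [hp, hq]⟩

theorem pow (hf : IsPoly f) (k : ℕ) : IsPoly fun n s => f n s ^ k := by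
  obtain ⟨p, hp⟩ := hf
  exact ⟨p ^ k, by simp [hp]⟩

theorem sum {ι : Type} [Fintype ι] {f : ι → ℕ → ℕ → ℕ} (hf : ∀ i, IsPoly (f i)) :
    IsPoly fun n s => ∑ i, f i n s := by
  choose p hp using hf
  exact ⟨∑ i, p i, by simp [hp]⟩

/-- The cost of a program is polynomial in the bound for the lengths of its loops. -/
theorem cost {K σ : Type} {Γ : K → Type} [∀ k, Fintype (Γ k)] (hf : IsPoly f) :
    ∀ p : Prog Γ σ, IsPoly fun n s => StackProg.cost (f n s) p
  | .push _ _ => const 1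
  | .load _ => const 1
  | .emit => const 1
  | .seq p q => (cost hf p).add (cost hf q)
  | .ite _ p q => (const 1).add ((cost hf p).add (cost hf q))
  | .pop _ b => (const 1).add (sum fun o => cost hf (b o))
  | .forEach _ b => (((const 4).mul hf).add (const 4)).add (hf.mul (sum fun c => cost hf (b c)))

end IsPoly

theorem eval_mono {ι : Type} (p : MvPolynomial ι ℕ) {x y : ι → ℕ} (h : x ≤ y) :
    MvPolynomial.eval x p ≤ MvPolynomial.eval y p := by
  induction p using MvPolynomial.induction_on with
  | C a => simp
  | add p q hp hq => simpa using Nat.add_le_add hp hq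
  | mul_X p i hp => simpa using Nat.mul_le_mul hp (h i)

/-- Supplies the initial budget: enough for `M` on every graph in the class with at most `n`
vertices, and of a form that `prepare` can compute. -/
theorem exists_eval_le (p : MvPolynomial (Fin 2) ℕ) :
    ∃ C k, ∀ m n, m ≤ n → MvPolynomial.eval ![m, 1] p ≤ C * (n + 1) ^ k := by
  induction p using MvPolynomial.induction_on with
  | C a => exact ⟨a, 0, by simp⟩
  | add p q hp hq =>
    obtain ⟨C₁, k₁, h₁⟩ := hp
    obtain ⟨C₂, k₂, h₂⟩ := hq
    refine ⟨C₁ + C₂, k₁ + k₂, fun m n hmn => ?_⟩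
    rw [map_add, Nat.add_mul]
    refine Nat.add_le_add ((h₁ m n hmn).trans ?_) ((h₂ m n hmn).trans ?_)
    · exact Nat.mul_le_mul_left _ (Nat.pow_le_pow_right n.succ_pos (Nat.le_add_right _ _))
    · exact Nat.mul_le_mul_left _ (Nat.pow_le_pow_right n.succ_pos (Nat.le_add_left _ _))
  | mul_X p i hp =>
    obtain ⟨C, k, h⟩ := hp
    refine ⟨C, k + 1, fun m n hmn => ?_⟩
    rw [map_mul, MvPolynomial.eval_X, pow_succ, ← Nat.mul_assoc]
    refine Nat.mul_le_mul (h m n hmn) ?_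
    fin_cases i
    · exact hmn.trans n.le_succ
    · simp

/-! ### The enumeration algorithm -/

variable {M : EnumMachine} {P : GraphClass} {n T B : ℕ} {G : SimpleGraph (Fin n)}

theorem IsSols.length_le {L : List (Set (Fin n))} (h : IsSols P G L) :
    L.length ≤ P.numSolutions G := by
  classical
  rw [← List.toFinset_card_of_nodup h.nodup, ← Set.ncard_coe_finset]
  exact Set.ncard_le_ncard (fun Z hZ => h.isMax Z (by simpa using hZ)) (Set.toFinite _)

/-- A maximal `P` set that lies in a member of `L` is equal to it. -/
theorem IsSols.mem_iff {L : List (Set (Fin n))} (h : IsSols P G L) (hL : Covers P G L Set.univ)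
    {Z : Set (Fin n)} : Z ∈ L ↔ P.IsMaximalSetOf G Z := by
  refine ⟨h.isMax Z, fun hZ => ?_⟩
  obtain ⟨W, hW, hZW⟩ := hL Z (Set.subset_univ Z) hZ.1
  by_contra hne
  exact hZ.2 W (hZW.ssubset_of_ne fun e => hne (e ▸ hW)) (h.isMax W hW).1

theorem IsSols.length_eq {L : List (Set (Fin n))} (h : IsSols P G L) (hL : Covers P G L Set.univ) :
    L.length = P.numSolutions G := by
  classical
  rw [← List.toFinset_card_of_nodup h.nodup, ← Set.ncard_coe_finset, GraphClass.numSolutions]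
  congr 1
  ext Z
  simpa using h.mem_iff hL

/-- A machine that solves the problem in polynomial total time meets the requirements of the main
loop as soon as the budget is large enough. -/
theorem fits_of_enumerates {p : MvPolynomial (Fin 2) ℕ}
    (hM : ∀ (n : ℕ) (G : SimpleGraph (Fin n)),
      M.EnumeratesWithin P G (MvPolynomial.eval ![n, P.numSolutions G] p))
    {C k : ℕ} (hC : ∀ m n, m ≤ n → MvPolynomial.eval ![m, 1] p ≤ C * (n + 1) ^ k)
    (hT : C * (n + 1) ^ k ≤ T) (hn : n * (n + 1) + T * growth M ≤ B) (hTB : T * (n + 1) ≤ B) :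
    Fits M P G T B where
  enum S := ⟨_, hM _ _⟩
  halts S hS := by
    have h := halted_of_haltsWithin (hM _ (sub G S)).1
    -- A graph in the class has one solution, which is why the bound at `(m, 1)` suffices.
    rw [numSolutions_of_mem (isSetOf_sub_univ.2 hS)] at h
    rw [simCfg_of_halted h ((hC _ n (length_elems_le S)).trans hT), h]
  graph_le := (Nat.le_add_right _ _).trans hn
  budget_le := (Nat.le_mul_of_pos_right T n.succ_pos).trans hTB
  stk_le S t ht j := by
    refine (length_simCfg_le _ t j).trans (le_trans (Nat.add_le_add ?_ ?_) hn)
    · rw [length_graphCode]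
      have := length_elems_le S
      exact Nat.mul_le_mul this (Nat.succ_le_succ this)
    · exact Nat.mul_le_mul_right _ ht
  res_le := hTB

/-- The enumeration machine: it repeats the main loop with increasing budgets. -/
noncomputable def incremental (M : EnumMachine) (C k : ℕ) : EnumMachine :=
  loopMachine (M := M) (prepare C k) stage fun c => c.finished

/-- The number `J` of stages is fixed in advance so that one `B` serves all of them. The last clause
concerns the most recent stage, whose budget was `T + i`. -/
theorem exists_reach (hP : P.Hereditary) {p : Pr M} {w : List (Option Bool)} {T J t₀ : ℕ}
    (hfits : ∀ j ≤ J, Fits M P G (T + j) B) (hB : J * ((n + 1) * (T + J)) * (n + 1) ≤ B)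
    (h₀ : Reach p stage (fun c => c.finished) w t₀ (st M G T (loopData [] [] [] false false))) :
    ∀ j ≤ J, ∃ t ≤ t₀ + j * (cost B (stage : Pr M) + 1), ∃ L, IsSols P G L ∧
      ((Covers P G L Set.univ ∧ ∃ T', Reach p stage (fun c => c.finished) w t
          (st M G T' (loopData [] [] L false true))) ∨
        (Reach p stage (fun c => c.finished) w t (st M G (T + j) (loopData [] [] L false false)) ∧
          L.length ≤ j * ((n + 1) * (T + J)) ∧ ∀ i, j = i + 1 →
            ∃ K, (simCfg M (graphCode (sub G K)) (T + i)).l ≠ none ∧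
              P.numSolutions (sub G K) ≤ L.length)) := by
  intro j
  induction j with
  | zero =>
    exact fun _ => ⟨t₀, by simp, [], ⟨List.nodup_nil, by simp⟩, .inr ⟨h₀, by simp, by simp⟩⟩
  | succ j ih =>
    intro hj
    obtain ⟨t, ht, L, hL, ⟨hcov, T', hr⟩ | ⟨hr, hlen, -⟩⟩ := ih (by omega)
    · exact ⟨t, ht.trans (by rw [Nat.succ_mul]; omega), L, hL, .inl ⟨hcov, T', hr⟩⟩
    · have hle : (n + 1) * (T + j) ≤ (n + 1) * (T + J) := Nat.mul_le_mul_left _ (by omega)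
      have hsucc : (j + 1) * ((n + 1) * (T + J)) = j * ((n + 1) * (T + J)) + (n + 1) * (T + J) :=
        Nat.succ_mul _ _
      have hJ : (j + 1) * ((n + 1) * (T + J)) ≤ J * ((n + 1) * (T + J)) := Nat.mul_le_mul_right _ hj
      have htime : (j + 1) * (cost B (stage : Pr M) + 1) =
        j * (cost B (stage : Pr M) + 1) + (cost B (stage : Pr M) + 1) := Nat.succ_mul _ _
      obtain ⟨L', hL', hlen', h⟩ := ex_stage hP (hfits j (by omega)) hL
        ((Nat.mul_le_mul_right _ (by omega)).trans hB)
      rcases h with ⟨hex, hcov⟩ | ⟨hex, K, hK, hN⟩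
      · obtain ⟨t', ht', hr'⟩ := hr.step rfl hex
        exact ⟨t', by omega, L', hL', .inl ⟨hcov, _, hr'⟩⟩
      · obtain ⟨t', ht', hr'⟩ := hr.step rfl hex
        refine ⟨t', by omega, L', hL', .inr ⟨hr', by omega, ?_⟩⟩
        rintro i hi
        obtain rfl : j = i := by omega
        exact ⟨K, hK, hN⟩

theorem emissions_prefix {w : List (Option Bool)} {t t' : ℕ} (h : t ≤ t') :
    emissions M w t <+: emissions M w t' := by
  induction t', h using Nat.le_induction with
  | base => exact List.prefix_rfl
  | succ t' _ ih =>
    rw [emissions_succ]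
    exact ih.trans (List.prefix_append _ _)

theorem emissions_of_halted {w : List (Option Bool)} {t t' : ℕ} (h : (simCfg M w t).l = none)
    (ht : t ≤ t') : emissions M w t' = emissions M w t := by
  induction t', ht using Nat.le_induction with
  | base => rfl
  | succ t' ht ih =>
    rw [emissions_succ, ih, simCfg_of_halted h ht]
    generalize simCfg M w t = c at h
    obtain ⟨l, v, S⟩ := c
    obtain rfl : l = none := h
    exact List.append_nil _

/-- `cfgAt` shows a halted configuration at the first halting time only, so one goes back to that
time. -/
theorem haltsWithin_of_halted {w : List (Option Bool)} : ∀ {t : ℕ}, (simCfg M w t).l = none →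
    M.HaltsWithin w t
  | 0, h => ⟨0, le_rfl, _, rfl, h⟩
  | t + 1, h => by
    by_cases h' : (simCfg M w t).l = none
    · obtain ⟨u, hu, hc⟩ := haltsWithin_of_halted h'
      exact ⟨u, hu.trans t.le_succ, hc⟩
    · rcases cfgAt_simCfg (M := M) (w := w) (t + 1) with hc | ⟨hc, -⟩
      · exact ⟨t + 1, le_rfl, _, hc, h⟩
      · rcases cfgAt_simCfg (M := M) (w := w) t with hc' | ⟨-, hc'⟩
        · rw [EnumMachine.cfgAt, hc'] at hc
          generalize simCfg M w t = c at hc h'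
          obtain ⟨_ | l, v, S⟩ := c
          · exact absurd rfl h'
          · cases hc
        · exact absurd hc' h'

end

/-! ### Time bounds and the equivalence -/

section

variable {M : EnumMachine} {P : GraphClass}

/-- A bound for the lengths of all loops while the budget is at most `T` and at most `J` iterations
of the main loop are made. -/
def loopBound (M : EnumMachine) (n T J : ℕ) : ℕ :=
  -- The first two terms bound the input code and the simulated stacks, the third the budget and the
  -- recorded words, the last the list of reported solutions.
  n * (n + 1) + T * growth M + T * (n + 1) + J * ((n + 1) * T) * (n + 1)

/-- A time bound for `J` iterations of the main loop. -/
noncomputable def timeBound (M : EnumMachine) (C k n J : ℕ) : ℕ :=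
  let B := loopBound M n (C * (n + 1) ^ k + J) J
  cost B (prepare C k : Pr M) + J * (cost B (stage : Pr M) + 1) + 1

theorem isPoly_timeBound {C k : ℕ} {f : ℕ → ℕ → ℕ} (hf : IsPoly f) :
    IsPoly fun n s => timeBound M C k n (f n s) := by
  have hn : IsPoly fun n _ => n + 1 := IsPoly.fst.add (.const 1)
  have hT : IsPoly fun n s => C * (n + 1) ^ k + f n s := ((IsPoly.const C).mul (hn.pow k)).add hf
  have hB : IsPoly fun n s => loopBound M n (C * (n + 1) ^ k + f n s) (f n s) :=
    (((IsPoly.fst.mul hn).add (hT.mul (.const _))).add (hT.mul hn)).add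
      ((hf.mul (hn.mul hT)).mul hn)
  exact ((hB.cost _).add (hf.mul ((hB.cost _).add (.const 1)))).add (.const 1)

/-- After `p(n, s) + 1` iterations of the main loop, the machine has halted or emitted more than `s`
solutions. -/
theorem incremental_spec (hP : P.Hereditary) {p : MvPolynomial (Fin 2) ℕ}
    (hM : ∀ (n : ℕ) (G : SimpleGraph (Fin n)),
      M.EnumeratesWithin P G (MvPolynomial.eval ![n, P.numSolutions G] p))
    {C k : ℕ} (hC : ∀ m n, m ≤ n → MvPolynomial.eval ![m, 1] p ≤ C * (n + 1) ^ k)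
    {n : ℕ} (G : SimpleGraph (Fin n)) (s : ℕ) {F : ℕ}
    (hF : F = timeBound M C k n (MvPolynomial.eval ![n, s] p + 1)) :
    ∃ L, IsSols P G L ∧ (L.map vertexSetCode).reverse <+:
        emissions (incremental M C k) (graphCode G) (F + 1) ∧
      (Covers P G L Set.univ ∧ (simCfg (incremental M C k) (graphCode G) F).l = none ∧
          emissions (incremental M C k) (graphCode G) (F + 1) = (L.map vertexSetCode).reverse ∨
        s < L.length) := by
  -- With this many stages the last one has budget `T + p(n, s)`, since the first has budget `T`.
  set J := MvPolynomial.eval ![n, s] p + 1 with hJ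
  set T := C * (n + 1) ^ k with hT
  set B := loopBound M n (T + J) J with hB
  have hfits : ∀ j ≤ J, Fits M P G (T + j) B := fun j hj => by
    have hle : T + j ≤ T + J := Nat.add_le_add_left hj T
    have h₁ := Nat.mul_le_mul_right (growth M) hle
    have h₂ := Nat.mul_le_mul_right (n + 1) hle
    refine fits_of_enumerates hM hC (Nat.le_add_right _ _) ?_ ?_ <;>
      · simp only [hB, loopBound]
        omega
  have hTB : T ≤ B := (Nat.le_add_right T 0).trans (hfits 0 (Nat.zero_le J)).budget_le
  have hinit := ex_prepare (M := M) (G := G) (d := loopData [] [] [] false false) (C := C) (k := k)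
    (hfits 0 (Nat.zero_le J)).graph_le hTB
  obtain ⟨t₀, ht₀, hr₀⟩ := reach_of_init (q := stage) (f := fun c => c.finished) (w := graphCode G)
    rfl (fun _ => rfl) rfl (fun v hv => by cases v <;> first | rfl | exact absurd rfl hv) rfl hinit
  obtain ⟨t, ht, L, hL, h⟩ := exists_reach hP hfits
    ((Nat.le_add_left _ _).trans_eq (by rw [hB, loopBound])) hr₀ J le_rfl
  have htF : t + 1 ≤ F := by
    have hF : F = cost B (prepare C k : Pr M) + J * (cost B (stage : Pr M) + 1) + 1 := hF
    omega
  refine ⟨L, hL, ?_⟩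
  rcases h with ⟨hcov, T', hr⟩ | ⟨hr, -, hK⟩
  · obtain ⟨h₁, h₂⟩ := hr.halted rfl
    have h₃ := emissions_of_halted h₁ (htF.trans F.le_succ)
    rw [h₂] at h₃
    exact ⟨h₃ ▸ List.prefix_rfl, .inl ⟨hcov, by rw [incremental, simCfg_of_halted h₁ htF, h₁], h₃⟩⟩
  · obtain ⟨r, -, he⟩ := hr
    refine ⟨?_, .inr (not_le.1 fun hs => ?_)⟩
    · change (st M G (T + J) (loopData [] [] L false false)).trace <+: _
      rw [← he]
      exact emissions_prefix (by omega)
    -- With at most `s` solutions reported, `G[K]` has at most `s` solutions and at most `n`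
    -- vertices, so `M` would have halted on it within the last budget.
    · obtain ⟨K, hK, hN⟩ := hK _ hJ
      have h := halted_of_haltsWithin (hM _ (sub G K)).1
      have hle : ![(elems K).length, P.numSolutions (sub G K)] ≤ ![n, s] := fun i => by
        fin_cases i
        · exact length_elems_le K
        · exact hN.trans hs
      exact hK (by rw [simCfg_of_halted h ((eval_mono p hle).trans (Nat.le_add_left _ _)), h])

theorem incremental_of_total (hP : P.Hereditary) (h : P.SolvableInPolynomialTotalTime) :
    P.SolvableInIncrementalPolynomialTime := by
  obtain ⟨M, p, hM⟩ := h
  obtain ⟨C, k, hC⟩ := exists_eval_le p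
  obtain ⟨q, hq⟩ := isPoly_timeBound (M := M) (C := C) (k := k)
    (f := fun n s => MvPolynomial.eval ![n, s] p + 1) (.add ⟨p, fun _ _ => rfl⟩ (.const 1))
  refine ⟨incremental M C k, q, fun n G => ⟨fun s _ hs => ?_, ?_⟩⟩
  · obtain ⟨L, hL, hpre, h⟩ := incremental_spec hP hM hC G s (hq n s)
    rw [outputs_eq]
    refine le_trans ?_ hpre.length_le
    rw [List.length_reverse, List.length_map]
    rcases h with ⟨hcov, -⟩ | h
    · rwa [hL.length_eq hcov]
    · exact h.le
  · obtain ⟨L, hL, -, h⟩ := incremental_spec hP hM hC G _ (hq n (P.numSolutions G))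
    rcases h with ⟨hcov, hhalt, hem⟩ | h
    · refine ⟨haltsWithin_of_halted hhalt, ?_, fun x => ?_⟩
      · rw [outputs_eq, hem, List.nodup_reverse]
        exact hL.nodup.map vertexSetCode_injective
      · rw [outputs_eq, hem, List.mem_reverse, List.mem_map]
        exact exists_congr fun U => and_congr_left' (hL.mem_iff hcov)
    -- For `s = N` the list cannot exceed `s`, so the machine must have finished.
    · exact absurd hL.length_le (not_le.2 h)

end

end StackProg

/-- For the converse, the second clause of incremental solvability is already a polynomial total
time bound. -/
theorem mainTheorem10 (P : GraphClass) (hP : P.Hereditary) :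
    P.SolvableInPolynomialTotalTime ↔ P.SolvableInIncrementalPolynomialTime :=
  ⟨StackProg.incremental_of_total hP, fun ⟨M, p, h⟩ => ⟨M, p, fun n G => (h n G).2⟩⟩
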